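/- A tracial $*$-probability space is a unital complex $*$-algebra $\mathcal A$ with a linear functional $\varphi$ such that $\varphi(1)=1$, $\varphi(a^*a)\ge 0$ and $\varphi(ab)=\varphi(ba)$ for all $a,b\in\mathcal A$. Its free cumulants are $$\kappa_n(a_1,\dots,a_n)=\sum_{\pi\in NC(n)}\mathrm{Moeb}(\pi,1_n)\prod_{V=\{i_1<\dots<i_m\}\in\pi}\varphi(a_{i_1}\cdots a_{i_m}),$$ where $NC(n)$ is the lattice of non-crossing partitions of $\{1,\dots,n\}$ ordered by reverse refinement, $\mathrm{Moeb}$ is its Möbius function and $1_n$ is the partition with one block. The S-transform of $a\in\mathcal A$ with $\varphi(a)\ne 0$ is the power series $S_a(z)=\frac{1+z}{z}\chi(z)$, where $\chi$ is the compositional inverse of $\sum_{m\ge 1}\varphi(a^m)z^m$. A free unitary Brownian motion is a family $(u_t)_{t\ge 0}$, where $u_t$ is a unitary element of a tracial $*$-probability space $(\mathcal A_t,\varphi_t)$ such that $\varphi_t(u_t)=e^{-t/2}$ and $v_t=e^{t/2}u_t$ has S-transform $S_{v_t}(z)=e^{tz}$. Write $u_t^{1}:=u_t$, and let $u_t^{*}$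 be the adjoint of $u_t$. For a string $\omega=(\omega(1),\dots,\omega(n))\in\{1,*\}^n$, let $\mathrm{Switch}(\omega)$ be the number of $i\in\{1,\dots,n\}$ with $\omega(i)\ne\omega(i+1)$, where $\omega(n+1):=\omega(1)$. **Theorem 3.7.** Let $n\ge 1$ and $\omega\in\{1,*\}^n$. There is a polynomial $Z_\omega\in\mathbb Q[x,y]$ such that, for every free unitary Brownian motion $(u_t)_{t\ge 0}$, $$\kappa_n\bigl(u_t^{\omega(1)},\dots,u_t^{\omega(n)}\bigr)=Z_\omega(t,e^{-t/2})\qquad\text{for all } t\in[0,\infty),$$ and $Z_\omega$ is the only polynomial in $\mathbb Q[x,y]$ with this property for $(u_t)_{t\ge 0}$. It has the form $$Z_\omega(x,y)=\sum_{0\le j\le n/2}Z_\omega^{(n-2j)}(x)\,y^{n-2j},\qquad Z_\omega^{(n-2j)}\in\mathbb Q[x],$$ and, for $0\le j\le n/2$, $$Z_\omega^{(n-2j)}=0\quad\text{whenever}\quad 2j>\mathrm{Switch}(\omega).$$ Consequently every power of $y$ that occurs in $Z_\omega$ is of the form $y^{n-2j}$ with $0\le j\le \mathrm{Switch}(\omega)/2$.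 -/

import Mathlib

open scoped NNReal ComplexOrder
open scoped Polynomial Polynomial.Bivariate

universe u

noncomputable section

namespace FreeBrownian

/-! ### Non-crossing partitions -/

/-- A partition of the linearly ordered set `Fin n` is non-crossing if there are no `a < b < c < d`
with `a, c` in one block and `b, d` in another block. -/
def IsNoncrossing {n : ℕ} (π : Finpartition (Finset.univ : Finset (Fin n))) : Prop :=
  ∀ V ∈ π.parts, ∀ W ∈ π.parts, ∀ a b c d : Fin n,
    a < b → b < c → c < d → a ∈ V → c ∈ V → b ∈ W → d ∈ W → V = W

/-- The poset `NC(n)`. The order is that of `Finpartition`: `π ≤ ρ` if and only if every block of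
`π` is contained in a block of `ρ` (reverse refinement). -/
abbrev NC (n : ℕ) : Type :=
  {π : Finpartition (Finset.univ : Finset (Fin n)) // IsNoncrossing π}

instance instFintypeNC (n : ℕ) : Fintype (NC n) := Fintype.ofFinite _

instance instLocallyFiniteOrderNC (n : ℕ) : LocallyFiniteOrder (NC n) := by
  classical exact Fintype.toLocallyFiniteOrder

theorem isNoncrossing_top (n : ℕ) :
    IsNoncrossing (⊤ : Finpartition (Finset.univ : Finset (Fin n))) := by
  intro V hV W hW a _ _ _ _ _ _ _ _ _ _
  have h := Finpartition.parts_top_subset (Finset.univ : Finset (Fin n))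
  rw [Finset.mem_singleton.1 (h hV), Finset.mem_singleton.1 (h hW)]

/-- The maximal element `1_n` of `NC(n)`: for `n ≥ 1`, the partition with a single block. -/
def NC.one (n : ℕ) : NC n := ⟨⊤, isNoncrossing_top n⟩

/-- The value `Moeb(π, 1_n)` of the Möbius function of the poset `NC(n)`. -/
def NC.moebOne {n : ℕ} (π : NC n) : ℤ := IncidenceAlgebra.mu ℤ π (NC.one n)

/-! ### Tracial `*`-probability spaces, moments and free cumulants -/

/-- A tracial `*`-probability space: a unital complex `*`-algebra with a positive unital tracial
linear functional. -/
structure TracialStarProbSpace where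
  carrier : Type u
  [ring : Ring carrier]
  [starRing : StarRing carrier]
  [algebra : Algebra ℂ carrier]
  [starModule : StarModule ℂ carrier]
  φ : carrier →ₗ[ℂ] ℂ
  map_one : φ 1 = 1
  nonneg : ∀ a : carrier, 0 ≤ φ (star a * a)
  tracial : ∀ a b : carrier, φ (a * b) = φ (b * a)

attribute [instance] TracialStarProbSpace.ring TracialStarProbSpace.starRing
  TracialStarProbSpace.algebra TracialStarProbSpace.starModule

section Functionals

variable {A : Type u} [Ring A] [Algebra ℂ A]

/-- The moment `φ(a_{i_1} ⋯ a_{i_m})` of the restriction of `(a_1, …, a_n)` to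
`V = {i_1 < ⋯ < i_m}`. -/
def restrictedMoment (φ : A →ₗ[ℂ] ℂ) {n : ℕ} (a : Fin n → A) (V : Finset (Fin n)) : ℂ :=
  φ (((V.sort).map a).prod)

/-- The free cumulant `κ_n(a_1, …, a_n) = ∑_{π ∈ NC(n)} Moeb(π, 1_n) ∏_{V ∈ π} φ((a_1, …, a_n)|V)`. -/
def freeCumulant (φ : A →ₗ[ℂ] ℂ) {n : ℕ} (a : Fin n → A) : ℂ :=
  ∑ π : NC n, (π.moebOne : ℂ) * ∏ V ∈ π.1.parts, restrictedMoment φ a V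

/-- The moment series `∑_{n ≥ 1} φ(a^n) z^n`. -/
def momentSeries (φ : A →ₗ[ℂ] ℂ) (a : A) : PowerSeries ℂ :=
  PowerSeries.mk fun n => if n = 0 then 0 else φ (a ^ n)

/-- `S` is the S-transform of `a`: `S(z) = ((1 + z) / z) χ(z)`, where `χ` is the inverse of the
moment series of `a` under composition. Such a `χ` exists if and only if `φ(a) ≠ 0`, and is then
unique. -/
def HasSTransform (φ : A →ₗ[ℂ] ℂ) (a : A) (S : PowerSeries ℂ) : Prop :=
  ∃ χ : PowerSeries ℂ, PowerSeries.constantCoeff χ = 0 ∧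
    PowerSeries.subst χ (momentSeries φ a) = PowerSeries.X ∧
    PowerSeries.subst (momentSeries φ a) χ = PowerSeries.X ∧
    PowerSeries.X * S = (1 + PowerSeries.X) * χ

end Functionals

/-! ### Free unitary Brownian motion -/

/-- A free unitary Brownian motion `(u_t)_{t ≥ 0}`: every `u_t` is a unitary in a tracial
`*`-probability space `(A_t, φ_t)`, with `φ_t(u_t) = e^{-t/2}`, and `v_t = e^{t/2} u_t` has
S-transform `e^{tz}`. -/
structure FreeUnitaryBrownianMotion where
  space : ℝ≥0 → TracialStarProbSpace.{u}
  elem : ∀ t, (space t).carrier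
  unitary : ∀ t, elem t ∈ unitary (space t).carrier
  mean : ∀ t : ℝ≥0, (space t).φ (elem t) = (Real.exp (-(t : ℝ) / 2) : ℂ)
  sTransform : ∀ t : ℝ≥0,
    HasSTransform (space t).φ ((Real.exp ((t : ℝ) / 2) : ℂ) • elem t)
      (PowerSeries.rescale ((t : ℝ) : ℂ) (PowerSeries.exp ℂ))

/-- The symbols `1` and `*`. -/
inductive Letter where
  | one : Letter
  | star : Letter
  deriving DecidableEq

/-- `a^1 = a` and `a^* = star a`. -/
def Letter.act {A : Type u} [Star A] (a : A) : Letter → A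
  | Letter.one => a
  | Letter.star => Star.star a

/-- The joint free cumulant `κ_n(u_t^{ω(1)}, …, u_t^{ω(n)})`. -/
def FreeUnitaryBrownianMotion.cumulant (U : FreeUnitaryBrownianMotion.{u}) (t : ℝ≥0) {n : ℕ}
    (ω : Fin n → Letter) : ℂ :=
  freeCumulant (U.space t).φ fun i => (ω i).act (U.elem t)

/-- The number of switches between `1` and `*` on going once around the string `ω` cyclically
(`finRotate n i` is the cyclic successor of `i`). -/
def switchNumber {n : ℕ} (ω : Fin n → Letter) : ℕ :=
  ∑ i : Fin n, if ω i = ω (finRotate n i) then 0 else 1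

/-- `Z(x, y)` for `Z ∈ ℚ[x, y]` and complex numbers `x, y`. Here `ℚ[X][Y]` is the ring of
polynomials in `y` whose coefficients are polynomials in `x`. -/
def evalXY (Z : ℚ[X][Y]) (x y : ℂ) : ℂ := Polynomial.aevalAeval x y Z

/-- `Z(t, e^{-t/2}) = κ_n(u_t^{ω(1)}, …, u_t^{ω(n)})` for all `t ≥ 0`. -/
def RepresentsCumulants (U : FreeUnitaryBrownianMotion.{u}) {n : ℕ} (ω : Fin n → Letter)
    (Z : ℚ[X][Y]) : Prop :=
  ∀ t : ℝ≥0, U.cumulant t ω = evalXY Z ((t : ℝ) : ℂ) (Real.exp (-(t : ℝ) / 2) : ℂ)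

end FreeBrownian

end

namespace FreeBrownian

open Finset

/-! Write `y = e^{-t/2}`. Inverting the S-transform gives `φ(u^k) = Q_k(t) y^k` with `Q_k` a
rational polynomial, for `k ≥ 0`. These numbers are real, so `u^{-k}` has the same moment. Since `u*
= u⁻¹`, the moment of a subword depends only on its net exponent `e`, and equals `Q_{|e|}(t)
y^{|e|}`. Substituting this in the Möbius formula gives the polynomial (`cumulantPoly`). The net
exponent of a block has the parity of its size and is at most that size in absolute value, so only
the powers `y^{n-2j}` occur. Uniqueness is the algebraic independence of `t` and `e^{-t/2}` on `[0,
∞)`.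

The vanishing statement is a divisibility: for every set `S` of positions, `y^{|S| - sw(S)}` divides
the cumulant `κ(S)`, where `sw(S)` counts the cyclic switches along `S`
(`pow_dvd_cumulantOf_wordMoment`). The proof is by induction on `S`. Without switches, the moment of
`S` is a multiple of `y^{|S|}`, and so are the products of smaller cumulants. Otherwise take cyclic
neighbours `i`, `j` in `S` with different letters. Deleting both leaves moments unchanged because `u
u* = 1`, and the moment-cumulant formula then gives, for `S ≠ {i, j}`, the relation `κ(S) = -∑ κ(A)
κ(B)` over non-crossing splittings `S = A ∪ B` with `i ∈ A`, `j ∈ B` (`mergedCumulant_cumulantOf`).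
Cutting at a switch never increases the total number of switches (`switchesOn_add_le`), so every
product has enough factors `y`.

Working with cumulants as a function of subsets makes this induction possible;
`sum_moebOne_mul_prod` identifies its value on the full set with the Möbius sum. -/

/-! ### Cyclic order and non-crossing families of blocks -/

/-- Going cyclically upwards from `a`, one strictly meets `b` before `c`. -/
def Cyc {n : ℕ} (a b c : Fin n) : Prop :=
  (a.val < b.val ∧ b.val < c.val) ∨ (b.val < c.val ∧ c.val < a.val) ∨
    (c.val < a.val ∧ a.val < b.val)

/-- Two blocks are apart if they are disjoint and do not cross. -/
def Apart {n : ℕ} (V W : Finset (Fin n)) : Prop :=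
  Disjoint V W ∧ ∀ a ∈ V, ∀ c ∈ V, ∀ b ∈ W, ∀ d ∈ W, ¬ (Cyc a b c ∧ Cyc c d a)

theorem Apart.symm {n : ℕ} {V W : Finset (Fin n)} (h : Apart V W) : Apart W V := by
  refine ⟨h.1.symm, fun a ha c hc b hb d hd hh => h.2 b hb d hd c hc a ha ?_⟩
  unfold Cyc at *; omega

theorem Apart.mono {n : ℕ} {V V' W : Finset (Fin n)} (h : Apart V W) (hV : V' ⊆ V) :
    Apart V' W :=
  ⟨h.1.mono_left hV, fun a ha c hc => h.2 a (hV ha) c (hV hc)⟩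

/-- `j` is the cyclic successor of `i` in `S`, and `i ≠ j`. -/
structure Adjacent {n : ℕ} (S : Finset (Fin n)) (i j : Fin n) : Prop where
  left_mem : i ∈ S
  right_mem : j ∈ S
  ne : i ≠ j
  not_between : ∀ x ∈ S, ¬ Cyc i x j

theorem Adjacent.mono {n : ℕ} {S T : Finset (Fin n)} {i j : Fin n} (h : Adjacent S i j)
    (hT : T ⊆ S) (hi : i ∈ T) (hj : j ∈ T) : Adjacent T i j :=
  ⟨hi, hj, h.ne, fun x hx => h.not_between x (hT hx)⟩

theorem cyc_or_cyc {n : ℕ} {a b c : Fin n} (h1 : b ≠ a) (h2 : b ≠ c) (h3 : a ≠ c) :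
    Cyc a b c ∨ Cyc c b a := by
  rw [ne_eq, Fin.ext_iff] at h1 h2 h3
  unfold Cyc
  omega

theorem Cyc.rotate {n : ℕ} {a b c : Fin n} (h : Cyc a b c) : Cyc b c a := by
  unfold Cyc at *
  omega

theorem Cyc.asymm {n : ℕ} {a b c : Fin n} (h : Cyc a b c) : ¬ Cyc c b a := by
  unfold Cyc at *
  omega

theorem Cyc.trans {n : ℕ} {a b c d : Fin n} (h : Cyc a b c) (h' : Cyc a c d) : Cyc a b d := by
  unfold Cyc at *
  omega

theorem Cyc.trans' {n : ℕ} {a b c d : Fin n} (h : Cyc a b c) (h' : Cyc a c d) : Cyc b c d := by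
  unfold Cyc at *
  omega

/-- Two points `b`, `d` of `W` cut the circle into two arcs. No point of `W` lies between `i` and
`j`, so these lie in the same arc. If `a ∈ A` and `c ∈ B` were in different arcs, then `W` would
cross `A` through `a`, `i` or `B` through `j`, `c`. -/
theorem Adjacent.apart_union {n : ℕ} {S A B W : Finset (Fin n)} {i j : Fin n}
    (h : Adjacent S i j) (hi : i ∈ A) (hj : j ∈ B) (hW : W ⊆ S)
    (hAW : Apart A W) (hBW : Apart B W) : Apart (A ∪ B) W := by
  have key : ∀ a ∈ A, ∀ c ∈ B, ∀ b ∈ W, ∀ d ∈ W, ¬ (Cyc a b c ∧ Cyc c d a) := by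
    intro a ha c hc b hb d hd hh
    obtain ⟨hb', hd'⟩ := hh
    have n1 : b ≠ i := fun e => disjoint_left.1 hAW.1 hi (e ▸ hb)
    have n2 : d ≠ i := fun e => disjoint_left.1 hAW.1 hi (e ▸ hd)
    have n3 : b ≠ j := fun e => disjoint_left.1 hBW.1 hj (e ▸ hb)
    have n5 : b ≠ d := fun e => hb'.asymm (e ▸ hd')
    have hbij : Cyc b i j :=
      ((cyc_or_cyc n1 n3 h.ne).resolve_left (h.not_between b (hW hb))).rotate
    have hacd : Cyc a c d := hd'.rotate.rotate
    have hbcd : Cyc b c d := hb'.trans' hacd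
    have hbda : Cyc b d a := (hb'.trans hacd).rotate
    rcases cyc_or_cyc n2 n5.symm n1.symm with hd'' | hd''
    · have hbid := hd''.rotate.rotate
      exact hAW.2 a ha i hi b hb d hd ⟨(hbid.trans hbda).rotate.rotate, hbid.trans' hbda⟩
    · have hbdj := hd''.trans hbij
      exact hBW.2 j hj c hc b hb d hd ⟨(hbcd.trans hbdj).rotate.rotate, hbcd.trans' hbdj⟩
  refine ⟨disjoint_union_left.2 ⟨hAW.1, hBW.1⟩, ?_⟩
  intro a ha c hc b hb d hd hh
  rcases mem_union.1 ha with ha | ha <;> rcases mem_union.1 hc with hc | hc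
  · exact hAW.2 a ha c hc b hb d hd hh
  · exact key a ha c hc b hb d hd hh
  · exact key c hc a ha d hd b hb ⟨hh.2, hh.1⟩
  · exact hBW.2 a ha c hc b hb d hd hh

theorem Adjacent.apart_pair {n : ℕ} {S W : Finset (Fin n)} {i j : Fin n}
    (h : Adjacent S i j) (hW : W ⊆ S \ {i, j}) : Apart {i, j} W := by
  refine ⟨disjoint_left.2 fun x hx hx' => (mem_sdiff.1 (hW hx')).2 hx, ?_⟩
  intro a ha c hc b hb d hd hh
  have h3 := h.not_between b (mem_sdiff.1 (hW hb)).1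
  have h4 := h.not_between d (mem_sdiff.1 (hW hd)).1
  simp only [mem_insert, mem_singleton] at ha hc
  rcases ha with rfl | rfl <;> rcases hc with rfl | rfl <;> unfold Cyc at * <;> omega

/-- `P` is a non-crossing partition of the set `S`. -/
structure IsNCP {n : ℕ} (S : Finset (Fin n)) (P : Finset (Finset (Fin n))) : Prop where
  nonempty : ∀ V ∈ P, V.Nonempty
  subset : ∀ V ∈ P, V ⊆ S
  cover : ∀ x ∈ S, ∃ V ∈ P, x ∈ V
  apart : ∀ V ∈ P, ∀ W ∈ P, V ≠ W → Apart V W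

theorem IsNCP.eq_of_mem {n : ℕ} {S : Finset (Fin n)} {P : Finset (Finset (Fin n))}
    (h : IsNCP S P) {V W : Finset (Fin n)} {x : Fin n} (hV : V ∈ P) (hW : W ∈ P) (hxV : x ∈ V)
    (hxW : x ∈ W) : V = W := by
  by_contra hne
  exact disjoint_left.1 (h.apart V hV W hW hne).1 hxV hxW

theorem isNCP_insert {n : ℕ} {S V : Finset (Fin n)} {τ : Finset (Finset (Fin n))} (hV : V ∉ τ) :
    IsNCP S (insert V τ) ↔
      V.Nonempty ∧ V ⊆ S ∧ IsNCP (S \ V) τ ∧ ∀ W ∈ τ, Apart V W := by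
  constructor
  · intro h
    have hap : ∀ W ∈ τ, Apart V W := fun W hW =>
      h.apart V (mem_insert_self _ _) W (mem_insert_of_mem hW) fun e => hV (e ▸ hW)
    refine ⟨h.nonempty V (mem_insert_self _ _), h.subset V (mem_insert_self _ _),
      ⟨fun W hW => h.nonempty W (mem_insert_of_mem hW), fun W hW x hx => ?_, fun x hx => ?_,
        fun W hW W' hW' => h.apart W (mem_insert_of_mem hW) W' (mem_insert_of_mem hW')⟩, hap⟩
    · exact mem_sdiff.2 ⟨h.subset W (mem_insert_of_mem hW) hx,
        fun hx' => disjoint_left.1 (hap W hW).1 hx' hx⟩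
    · obtain ⟨W, hW, hxW⟩ := h.cover x (mem_sdiff.1 hx).1
      rcases mem_insert.1 hW with rfl | hW
      · exact absurd hxW (mem_sdiff.1 hx).2
      · exact ⟨W, hW, hxW⟩
  · rintro ⟨hne, hVS, hτ, hap⟩
    refine ⟨?_, ?_, ?_, ?_⟩
    · simp only [mem_insert, forall_eq_or_imp]
      exact ⟨hne, hτ.nonempty⟩
    · simp only [mem_insert, forall_eq_or_imp]
      exact ⟨hVS, fun W hW => (hτ.subset W hW).trans sdiff_subset⟩
    · intro x hx
      by_cases hxV : x ∈ V
      · exact ⟨V, mem_insert_self _ _, hxV⟩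
      · obtain ⟨W, hW, hxW⟩ := hτ.cover x (mem_sdiff.2 ⟨hx, hxV⟩)
        exact ⟨W, mem_insert_of_mem hW, hxW⟩
    · intro W hW W' hW' hWW
      rcases mem_insert.1 hW with e | hW <;> rcases mem_insert.1 hW' with e' | hW'
      · exact absurd (e.trans e'.symm) hWW
      · exact e ▸ hap W' hW'
      · exact e' ▸ (hap W hW).symm
      · exact hτ.apart _ hW _ hW' hWW

theorem isNCP_empty_iff {n : ℕ} {P : Finset (Finset (Fin n))} : IsNCP ∅ P ↔ P = ∅ := by
  constructor
  · intro h
    refine eq_empty_of_forall_notMem fun V hV => ?_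
    obtain ⟨x, hx⟩ := h.nonempty V hV
    exact absurd (h.subset V hV hx) (notMem_empty x)
  · rintro rfl
    exact ⟨by simp, by simp, by simp, by simp⟩

theorem IsNCP.singleton {n : ℕ} {S : Finset (Fin n)} (hS : S.Nonempty) : IsNCP S {S} :=
  ⟨by simpa, by simp, fun x hx => ⟨S, by simp, hx⟩, by simp⟩

theorem IsNCP.eq_singleton {n : ℕ} {S : Finset (Fin n)} {P : Finset (Finset (Fin n))}
    (h : IsNCP S P) (hS : S ∈ P) : P = {S} := by
  refine eq_singleton_iff_unique_mem.2 ⟨hS, fun V hV => ?_⟩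
  obtain ⟨x, hx⟩ := h.nonempty V hV
  exact h.eq_of_mem hV hS hx (h.subset V hV hx)

open Classical in
/-- The set of non-crossing partitions of `S`. -/
noncomputable def ncp {n : ℕ} (S : Finset (Fin n)) : Finset (Finset (Finset (Fin n))) :=
  univ.filter (IsNCP S)

@[simp] theorem mem_ncp {n : ℕ} {S : Finset (Fin n)} {P : Finset (Finset (Fin n))} :
    P ∈ ncp S ↔ IsNCP S P := by
  simp [ncp]

theorem ncp_empty {n : ℕ} : ncp (∅ : Finset (Fin n)) = {∅} := by
  ext P; simp [isNCP_empty_iff]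

theorem card_eq_sum_of_isNCP {n : ℕ} {S : Finset (Fin n)} {P : Finset (Finset (Fin n))}
    (h : IsNCP S P) : S.card = ∑ V ∈ P, V.card := by
  rw [← card_biUnion fun V hV W hW hne => (h.apart V hV W hW hne).1]
  congr 1
  ext x
  simp only [mem_biUnion]
  exact ⟨fun hx => h.cover x hx, fun ⟨V, hV, hx⟩ => h.subset V hV hx⟩

/-! ### Cumulants as a set function, and the effect of deleting two neighbours -/

section Cumulants

variable {R : Type*} [CommRing R] {n : ℕ}

/-- The sum over non-crossing partitions of `S` of the products of the weights of the blocks. -/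
noncomputable def ncpSum (K : Finset (Fin n) → R) (S : Finset (Fin n)) : R :=
  ∑ P ∈ ncp S, ∏ V ∈ P, K V

open Classical in
/-- The set function of free cumulants belonging to the set function `F` of moments. -/
noncomputable def cumulantOf (F : Finset (Fin n) → R) (S : Finset (Fin n)) : R :=
  F S - ∑ P ∈ ((ncp S).erase {S}).attach, ∏ V ∈ P.1.attach, cumulantOf F V.1
termination_by S.card
decreasing_by
  -- The recursion only meets proper subsets: a partition of `S` with `S` as a block is `{S}`, which
  -- is excluded.
  have hP := mem_erase.1 P.2
  have h := mem_ncp.1 hP.2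
  refine card_lt_card (Finset.ssubset_iff_subset_ne.2 ⟨h.subset _ V.2, fun e => hP.1 ?_⟩)
  have hV := V.2
  rw [e] at hV
  exact h.eq_singleton hV

open Classical in
theorem cumulantOf_eq (F : Finset (Fin n) → R) (S : Finset (Fin n)) :
    cumulantOf F S = F S - ∑ P ∈ (ncp S).erase {S}, ∏ V ∈ P, cumulantOf F V := by
  rw [cumulantOf, sum_attach ((ncp S).erase {S}) fun P => ∏ V ∈ P.attach, cumulantOf F V.1]
  congr 1
  exact sum_congr rfl fun P _ => prod_attach P (cumulantOf F)

theorem ncpSum_cumulantOf (F : Finset (Fin n) → R) (hF : F ∅ = 1) (S : Finset (Fin n)) :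
    ncpSum (cumulantOf F) S = F S := by
  classical
  rcases S.eq_empty_or_nonempty with rfl | hS
  · simp [ncpSum, ncp_empty, hF]
  · rw [ncpSum, ← add_sum_erase _ _ (mem_ncp.2 (IsNCP.singleton hS)), prod_singleton,
      cumulantOf_eq]
    ring

open Classical in
/-- The weights of the non-crossing partitions of `S` having the block `V`, without the
weight of `V`. -/
noncomputable def restSum (K : Finset (Fin n) → R) (S V : Finset (Fin n)) : R :=
  ∑ τ ∈ (ncp (S \ V)).filter (fun τ => ∀ W ∈ τ, Apart V W), ∏ W ∈ τ, K W

open Classical in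
/-- The sum of `K V` and of the products `K A * K B` over non-crossing partitions `{A, B}` of `V`
with `i ∈ A` and `j ∉ A`. -/
noncomputable def mergedCumulant (K : Finset (Fin n) → R) (i j : Fin n) (V : Finset (Fin n)) : R :=
  K V + ∑ A ∈ V.powerset.filter (fun A => i ∈ A ∧ j ∉ A ∧ Apart A (V \ A)), K A * K (V \ A)

open Classical in
theorem sum_ncp_joined (K : Finset (Fin n) → R) {S : Finset (Fin n)} (i j : Fin n) :
    ∑ P ∈ (ncp S).filter (fun P => ∃ V ∈ P, i ∈ V ∧ j ∈ V), ∏ V ∈ P, K V =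
      ∑ V ∈ S.powerset.filter (fun V => i ∈ V ∧ j ∈ V), K V * restSum K S V := by
  simp only [restSum, mul_sum]
  rw [sum_sigma']
  symm
  have hnot : ∀ x : (_ : Finset (Fin n)) × Finset (Finset (Fin n)), i ∈ x.1 →
      IsNCP (S \ x.1) x.2 → x.1 ∉ x.2 := fun x hx h hm =>
    (mem_sdiff.1 (h.subset _ hm hx)).2 hx
  refine sum_bij (fun x _ => insert x.1 x.2) ?_ ?_ ?_ ?_
  · intro x hx
    simp only [mem_sigma, mem_filter, mem_powerset, mem_ncp] at hx ⊢
    exact ⟨(isNCP_insert (hnot x hx.1.2.1 hx.2.1)).2 ⟨⟨i, hx.1.2.1⟩, hx.1.1, hx.2.1, hx.2.2⟩,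
      x.1, mem_insert_self _ _, hx.1.2⟩
  · rintro ⟨V, τ⟩ hx ⟨V', τ'⟩ hx' e
    simp only [mem_sigma, mem_filter, mem_powerset, mem_ncp] at hx hx' e
    have n1 : V ∉ τ := hnot ⟨V, τ⟩ hx.1.2.1 hx.2.1
    have n2 : V' ∉ τ' := hnot ⟨V', τ'⟩ hx'.1.2.1 hx'.2.1
    have h := (isNCP_insert n1).2 ⟨⟨i, hx.1.2.1⟩, hx.1.1, hx.2.1, hx.2.2⟩
    have hV : V = V' := h.eq_of_mem (mem_insert_self _ _) (e ▸ mem_insert_self _ _) hx.1.2.1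
      hx'.1.2.1
    subst hV
    have : τ = τ' := by rw [← erase_insert n1, e, erase_insert n2]
    rw [this]
  · intro P hP
    simp only [mem_filter, mem_ncp] at hP
    obtain ⟨hP, V, hV, hi, hj⟩ := hP
    have h := (isNCP_insert (notMem_erase V P)).1 ((insert_erase hV).symm ▸ hP)
    refine ⟨⟨V, P.erase V⟩, ?_, insert_erase hV⟩
    simp only [mem_sigma, mem_filter, mem_powerset, mem_ncp]
    exact ⟨⟨h.2.1, hi, hj⟩, h.2.2.1, h.2.2.2⟩
  · intro x hx
    simp only [mem_sigma, mem_filter, mem_powerset, mem_ncp] at hx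
    rw [prod_insert (hnot x hx.1.2.1 hx.2.1)]

-- Merging the block `A` of `i` with the block `B` of `j` into `V = A ∪ B` turns a separated
-- partition into a joined one with a marked splitting of `V`. Adjacency of `i` and `j` ensures that
-- the merged block crosses no other block.
open Classical in
theorem sum_ncp_separated (K : Finset (Fin n) → R) {S : Finset (Fin n)} {i j : Fin n}
    (hadj : Adjacent S i j) :
    ∑ P ∈ (ncp S).filter (fun P => ¬ ∃ V ∈ P, i ∈ V ∧ j ∈ V), ∏ V ∈ P, K V =
      ∑ V ∈ S.powerset.filter (fun V => i ∈ V ∧ j ∈ V),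
        (∑ A ∈ V.powerset.filter (fun A => i ∈ A ∧ j ∉ A ∧ Apart A (V \ A)),
          K A * K (V \ A)) * restSum K S V := by
  simp only [restSum, sum_mul_sum]
  rw [sum_sigma']
  rw [sum_sigma']
  symm
  have main : ∀ V A : Finset (Fin n), ∀ τ : Finset (Finset (Fin n)),
      V ⊆ S → i ∈ V → j ∈ V → A ⊆ V → i ∈ A → j ∉ A → Apart A (V \ A) → IsNCP (S \ V) τ →
      (∀ W ∈ τ, Apart V W) →
      A ∉ insert (V \ A) τ ∧ V \ A ∉ τ ∧ IsNCP S (insert A (insert (V \ A) τ)) := by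
    intro V A τ hV hi hj hAV hiA hjA hap hτ hapτ
    have n1 : A ∉ insert (V \ A) τ := by
      intro h
      rcases mem_insert.1 h with h | h
      · have := h ▸ hiA
        exact (mem_sdiff.1 this).2 hiA
      · exact (mem_sdiff.1 (hτ.subset _ h hiA)).2 hi
    have n2 : V \ A ∉ τ := fun h =>
      (mem_sdiff.1 (hτ.subset _ h (mem_sdiff.2 ⟨hj, hjA⟩))).2 hj
    refine ⟨n1, n2, (isNCP_insert n1).2 ⟨⟨i, hiA⟩, hAV.trans hV, (isNCP_insert n2).2
      ⟨⟨j, mem_sdiff.2 ⟨hj, hjA⟩⟩, sdiff_subset_sdiff hV le_rfl, ?_,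
        fun W hW => (hapτ W hW).mono sdiff_subset⟩, ?_⟩⟩
    · rwa [sdiff_sdiff_left, sup_eq_union, union_sdiff_of_subset hAV]
    · intro W hW
      rcases mem_insert.1 hW with rfl | hW
      · exact hap
      · exact (hapτ W hW).mono hAV
  refine sum_bij (fun x _ => insert x.1.2 (insert (x.1.1 \ x.1.2) x.2)) ?_ ?_ ?_ ?_
  · rintro ⟨⟨V, A⟩, τ⟩ hx
    simp only [mem_sigma, mem_filter, mem_powerset, mem_ncp] at hx ⊢
    obtain ⟨⟨⟨hV, hi, hj⟩, hAV, hiA, hjA, hap⟩, hτ, hapτ⟩ := hx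
    obtain ⟨n1, n2, h⟩ := main V A τ hV hi hj hAV hiA hjA hap hτ hapτ
    refine ⟨h, ?_⟩
    rintro ⟨W, hW, hiW, hjW⟩
    have := h.eq_of_mem hW (mem_insert_self _ _) hiW hiA
    exact hjA (this ▸ hjW)
  · rintro ⟨⟨V, A⟩, τ⟩ hx ⟨⟨V', A'⟩, τ'⟩ hx' e
    simp only [mem_sigma, mem_filter, mem_powerset, mem_ncp] at hx hx' e
    obtain ⟨⟨⟨hV, hi, hj⟩, hAV, hiA, hjA, hap⟩, hτ, hapτ⟩ := hx
    obtain ⟨⟨⟨hV', hi', hj'⟩, hAV', hiA', hjA', hap'⟩, hτ', hapτ'⟩ := hx'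
    obtain ⟨n1, n2, h⟩ := main V A τ hV hi hj hAV hiA hjA hap hτ hapτ
    obtain ⟨n1', n2', h'⟩ := main V' A' τ' hV' hi' hj' hAV' hiA' hjA' hap' hτ' hapτ'
    have hA : A = A' := h.eq_of_mem (mem_insert_self _ _) (e ▸ mem_insert_self _ _) hiA hiA'
    have hB : V \ A = V' \ A' := h.eq_of_mem (mem_insert_of_mem (mem_insert_self _ _))
      (e ▸ mem_insert_of_mem (mem_insert_self _ _)) (mem_sdiff.2 ⟨hj, hjA⟩)
      (mem_sdiff.2 ⟨hj', hjA'⟩)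
    have hVV : V = V' := by
      rw [← union_sdiff_of_subset hAV, hB, hA, union_sdiff_of_subset hAV']
    subst hA hVV
    have : τ = τ' := by
      rw [← erase_insert n2, ← erase_insert n1, e, erase_insert n1', erase_insert n2']
    rw [this]
  · intro P hP
    simp only [mem_filter, mem_ncp] at hP
    obtain ⟨hP, hsep⟩ := hP
    obtain ⟨A, hA, hiA⟩ := hP.cover i hadj.left_mem
    obtain ⟨B, hB, hjB⟩ := hP.cover j hadj.right_mem
    have hjA : j ∉ A := fun h => hsep ⟨A, hA, hiA, h⟩
    have hAB : A ≠ B := fun h => hjA (h ▸ hjB)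
    have hB' : B ∈ P.erase A := mem_erase.2 ⟨hAB.symm, hB⟩
    have hPe : insert A (insert B ((P.erase A).erase B)) = P := by
      rw [insert_erase hB', insert_erase hA]
    have nB := notMem_erase B (P.erase A)
    have nA : A ∉ insert B ((P.erase A).erase B) := by
      rw [insert_erase hB']; exact notMem_erase _ _
    have h := (isNCP_insert nA).1 (hPe.symm ▸ hP)
    have h2 := (isNCP_insert nB).1 h.2.2.1
    have hsd : (A ∪ B) \ A = B := by
      rw [union_sdiff_left]
      exact sdiff_eq_self_of_disjoint (hP.apart A hA B hB hAB).1.symm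
    have hBS := hP.subset B hB
    refine ⟨⟨⟨A ∪ B, A⟩, (P.erase A).erase B⟩, ?_, by simp only [hsd]; exact hPe⟩
    simp only [mem_sigma, mem_filter, mem_powerset, mem_ncp, hsd]
    refine ⟨⟨⟨union_subset h.2.1 hBS, mem_union_left _ hiA, mem_union_right _ hjB⟩,
      subset_union_left, hiA, hjA, hP.apart A hA B hB hAB⟩, ?_, ?_⟩
    · have := h2.2.2.1
      rwa [sdiff_sdiff_left, sup_eq_union] at this
    · intro W hW
      exact hadj.apart_union hiA hjB
        (hP.subset W (mem_of_mem_erase (mem_of_mem_erase hW)))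
        (h.2.2.2 W (mem_insert_of_mem hW)) (h2.2.2.2 W hW)
  · rintro ⟨⟨V, A⟩, τ⟩ hx
    simp only [mem_sigma, mem_filter, mem_powerset, mem_ncp] at hx ⊢
    obtain ⟨⟨⟨hV, hi, hj⟩, hAV, hiA, hjA, hap⟩, hτ, hapτ⟩ := hx
    obtain ⟨n1, n2, h⟩ := main V A τ hV hi hj hAV hiA hjA hap hτ hapτ
    rw [prod_insert n1, prod_insert n2, mul_assoc]

open Classical in
theorem ncpSum_eq_sum_merged (K : Finset (Fin n) → R) {S : Finset (Fin n)} {i j : Fin n}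
    (hadj : Adjacent S i j) :
    ncpSum K S = ∑ V ∈ S.powerset.filter (fun V => i ∈ V ∧ j ∈ V),
      mergedCumulant K i j V * restSum K S V := by
  rw [ncpSum, ← sum_filter_add_sum_filter_not _ (fun P => ∃ V ∈ P, i ∈ V ∧ j ∈ V),
    sum_ncp_joined K i j, sum_ncp_separated K hadj, ← sum_add_distrib]
  simp only [mergedCumulant, add_mul]

theorem restSum_self (K : Finset (Fin n) → R) (S : Finset (Fin n)) : restSum K S S = 1 := by
  classical
  rw [restSum, sdiff_self, bot_eq_empty, ncp_empty, filter_singleton]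
  simp

theorem restSum_pair (K : Finset (Fin n) → R) {S : Finset (Fin n)} {i j : Fin n}
    (hadj : Adjacent S i j) : restSum K S {i, j} = ncpSum K (S \ {i, j}) := by
  classical
  rw [restSum, ncpSum, filter_true_of_mem]
  intro τ hτ W hW
  exact hadj.apart_pair ((mem_ncp.1 hτ).subset W hW)

/-- Cumulants whose moments do not change when two cyclically adjacent entries `i`, `j`
are removed. -/
theorem mergedCumulant_cumulantOf (F : Finset (Fin n) → R) (hF : F ∅ = 1) {i j : Fin n}
    (hred : ∀ S : Finset (Fin n), i ∈ S → j ∈ S → F S = F (S \ {i, j})) (S : Finset (Fin n))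
    (hadj : Adjacent S i j) :
    mergedCumulant (cumulantOf F) i j S = if S = {i, j} then 1 else 0 := by
  classical
  induction S using Finset.strongInduction with
  | H S ih =>
    have h := ncpSum_eq_sum_merged (cumulantOf F) hadj
    rw [ncpSum_cumulantOf F hF, hred S hadj.left_mem hadj.right_mem] at h
    have hSm : S ∈ S.powerset.filter (fun V => i ∈ V ∧ j ∈ V) := by
      simp [hadj.left_mem, hadj.right_mem]
    rw [← add_sum_erase _ _ hSm, restSum_self, mul_one] at h
    -- By induction, `{i, j}` is the only proper subset that can contribute; its merged cumulant is
    -- 1 and its remaining factor is the moment of `S \ {i, j}`.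
    have h2 : ∑ V ∈ (S.powerset.filter (fun V => i ∈ V ∧ j ∈ V)).erase S,
        mergedCumulant (cumulantOf F) i j V * restSum (cumulantOf F) S V =
        ∑ V ∈ (S.powerset.filter (fun V => i ∈ V ∧ j ∈ V)).erase S,
          if V = {i, j} then F (S \ {i, j}) else 0 := by
      refine sum_congr rfl fun V hV => ?_
      simp only [mem_erase, mem_filter, mem_powerset] at hV
      rw [ih V (Finset.ssubset_iff_subset_ne.2 ⟨hV.2.1, hV.1⟩)
        (hadj.mono hV.2.1 hV.2.2.1 hV.2.2.2)]
      split_ifs with e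
      · rw [e, restSum_pair _ hadj, ncpSum_cumulantOf F hF, one_mul]
      · rw [zero_mul]
    rw [h2, sum_ite_eq'] at h
    have hsub : ({i, j} : Finset (Fin n)) ⊆ S := by
      simp [insert_subset_iff, hadj.left_mem, hadj.right_mem]
    -- For `S = {i, j}` the remaining sum is empty and the left side is `F ∅ = 1`. Otherwise the
    -- term of `{i, j}` already accounts for the whole left side, so the merged cumulant of `S` is
    -- zero.
    by_cases e : S = {i, j}
    · rw [if_pos e]
      rw [if_neg (by simp [e]), add_zero, ← e, sdiff_self, bot_eq_empty, hF] at h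
      exact h.symm
    · rw [if_neg e]
      rw [if_pos (by simp [mem_erase, hsub, Ne.symm e])] at h
      linear_combination -h

end Cumulants

/-! ### Möbius inversion on the non-crossing partitions -/

theorem isNCP_parts {n : ℕ} (π : NC n) : IsNCP univ π.1.parts := by
  refine ⟨fun V hV => π.1.nonempty_of_mem_parts hV, fun V _ => subset_univ V,
    fun x hx => π.1.exists_mem hx, fun V hV W hW hne => ⟨π.1.disjoint hV hW hne, ?_⟩⟩
  intro a ha c hc b hb d hd hh
  have h1 := π.2 V hV W hW
  have h2 := π.2 W hW V hV
  have key : (a < b ∧ b < c ∧ c < d) ∨ (b < c ∧ c < d ∧ d < a) ∨ (c < d ∧ d < a ∧ a < b) ∨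
      (d < a ∧ a < b ∧ b < c) := by
    simp only [Fin.lt_def]
    unfold Cyc at hh
    omega
  rcases key with ⟨k1, k2, k3⟩ | ⟨k1, k2, k3⟩ | ⟨k1, k2, k3⟩ | ⟨k1, k2, k3⟩
  · exact hne (h1 a b c d k1 k2 k3 ha hc hb hd)
  · exact hne (h2 b c d a k1 k2 k3 hb hd hc ha).symm
  · exact hne (h1 c d a b k1 k2 k3 hc ha hd hb)
  · exact hne (h2 d a b c k1 k2 k3 hd hb ha hc).symm

theorem IsNCP.exists_nc {n : ℕ} {P : Finset (Finset (Fin n))} (h : IsNCP univ P) :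
    ∃ π : NC n, π.1.parts = P := by
  refine ⟨⟨⟨P, ?_, ?_, ?_⟩, ?_⟩, rfl⟩
  · rw [supIndep_iff_pairwiseDisjoint]
    exact fun V hV W hW hne => (h.apart V hV W hW hne).1
  · ext x
    simp only [mem_sup, id, mem_univ, iff_true]
    exact h.cover x (mem_univ x)
  · exact fun hm => not_nonempty_empty (h.nonempty ∅ hm)
  · intro V hV W hW a b c d hab hbc hcd ha hc hb hd
    by_contra hne
    refine (h.apart V hV W hW hne).2 a ha c hc b hb d hd ?_
    rw [Fin.lt_def] at *
    unfold Cyc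
    omega

/-- Every block of `P` is contained in a block of `Q`. -/
def Refines {n : ℕ} (P Q : Finset (Finset (Fin n))) : Prop :=
  ∀ W ∈ P, ∃ V ∈ Q, W ⊆ V

section

variable {R : Type*} [CommRing R] {n : ℕ}

-- Choosing a non-crossing partition inside each block of `Q` amounts to choosing one non-crossing
-- refinement of `Q`. In the induction, the refinement is split into the blocks inside `V` and the
-- others.
open Classical in
theorem prod_ncpSum (K : Finset (Fin n) → R) (Q : Finset (Finset (Fin n))) :
    ∀ S : Finset (Fin n), IsNCP S Q →
      ∏ V ∈ Q, ncpSum K V = ∑ P ∈ (ncp S).filter (fun P => Refines P Q), ∏ W ∈ P, K W := by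
  induction Q using Finset.induction_on with
  | empty =>
    intro S hS
    have : S = ∅ := eq_empty_of_forall_notMem fun x hx => by simpa using hS.cover x hx
    subst this
    rw [ncp_empty, filter_singleton, if_pos (by simp [Refines])]
    simp
  | insert V τ hV ih =>
    intro S hS
    obtain ⟨hne, hVS, hτ, hap⟩ := (isNCP_insert hV).1 hS
    have hdisj : ∀ W ∈ τ, ∀ A : Finset (Fin n), A.Nonempty → A ⊆ W → ¬ A ⊆ V := by
      rintro W hW A ⟨x, hx⟩ hAW hAV
      exact disjoint_left.1 (hap W hW).1 (hAV hx) (hAW hx)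
    have hsep : ∀ P₁ P₂ : Finset (Finset (Fin n)), IsNCP V P₁ → IsNCP (S \ V) P₂ →
        Refines P₂ τ → (P₁ ∪ P₂).filter (· ⊆ V) = P₁ ∧ (P₁ ∪ P₂).filter (¬ · ⊆ V) = P₂ := by
      intro P₁ P₂ h₁ h₂ hr
      have e : ∀ W ∈ P₂, ¬ W ⊆ V := fun W hW => by
        obtain ⟨V', hV', hWV⟩ := hr W hW
        exact hdisj V' hV' W (h₂.nonempty W hW) hWV
      rw [filter_union, filter_union, filter_true_of_mem h₁.subset, filter_false_of_mem e,
        filter_false_of_mem fun W hW => not_not.2 (h₁.subset W hW), filter_true_of_mem e]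
      simp
    rw [prod_insert hV, ih _ hτ, ncpSum, sum_mul_sum, ← sum_product']
    refine sum_bij' (fun x _ => x.1 ∪ x.2)
      (fun P _ => (P.filter (· ⊆ V), P.filter (¬ · ⊆ V))) ?_ ?_ ?_ ?_ ?_
    · rintro ⟨P₁, P₂⟩ hx
      simp only [mem_product, mem_filter, mem_ncp] at hx ⊢
      obtain ⟨h₁, h₂, hr⟩ := hx
      have hcross : ∀ A ∈ P₁, ∀ B ∈ P₂, Apart A B := by
        intro A hA B hB
        obtain ⟨V', hV', hBV⟩ := hr B hB
        exact (((hap V' hV').mono (h₁.subset A hA)).symm.mono hBV).symm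
      refine ⟨⟨?_, ?_, ?_, ?_⟩, ?_⟩
      · intro W hW
        rcases mem_union.1 hW with hW | hW
        exacts [h₁.nonempty W hW, h₂.nonempty W hW]
      · intro W hW
        rcases mem_union.1 hW with hW | hW
        exacts [(h₁.subset W hW).trans hVS, (h₂.subset W hW).trans sdiff_subset]
      · intro x hx
        by_cases hxV : x ∈ V
        · obtain ⟨W, hW, hxW⟩ := h₁.cover x hxV
          exact ⟨W, mem_union_left _ hW, hxW⟩
        · obtain ⟨W, hW, hxW⟩ := h₂.cover x (mem_sdiff.2 ⟨hx, hxV⟩)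
          exact ⟨W, mem_union_right _ hW, hxW⟩
      · intro A hA B hB hAB
        rcases mem_union.1 hA with hA | hA <;> rcases mem_union.1 hB with hB | hB
        exacts [h₁.apart A hA B hB hAB, hcross A hA B hB, (hcross B hB A hA).symm,
          h₂.apart A hA B hB hAB]
      · intro W hW
        rcases mem_union.1 hW with hW | hW
        · exact ⟨V, mem_insert_self _ _, h₁.subset W hW⟩
        · obtain ⟨V', hV', hWV⟩ := hr W hW
          exact ⟨V', mem_insert_of_mem hV', hWV⟩
    · intro P hP
      simp only [mem_product, mem_filter, mem_ncp] at hP ⊢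
      obtain ⟨h, hr⟩ := hP
      have hr' : ∀ W ∈ P, ¬ W ⊆ V → ∃ V' ∈ τ, W ⊆ V' := by
        intro W hW hWV
        obtain ⟨V', hV', hWV'⟩ := hr W hW
        rcases mem_insert.1 hV' with rfl | hV'
        exacts [absurd hWV' hWV, ⟨V', hV', hWV'⟩]
      refine ⟨⟨fun W hW => h.nonempty W (mem_filter.1 hW).1, fun W hW => (mem_filter.1 hW).2, ?_,
        fun A hA B hB => h.apart A (mem_filter.1 hA).1 B (mem_filter.1 hB).1⟩,
        ⟨fun W hW => h.nonempty W (mem_filter.1 hW).1, ?_, ?_,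
        fun A hA B hB => h.apart A (mem_filter.1 hA).1 B (mem_filter.1 hB).1⟩,
        fun W hW => hr' W (mem_filter.1 hW).1 (mem_filter.1 hW).2⟩
      · intro x hx
        obtain ⟨W, hW, hxW⟩ := h.cover x (hVS hx)
        refine ⟨W, mem_filter.2 ⟨hW, ?_⟩, hxW⟩
        by_contra hWV
        obtain ⟨V', hV', hWV'⟩ := hr' W hW hWV
        exact disjoint_left.1 (hap V' hV').1 hx (hWV' hxW)
      · intro W hW
        obtain ⟨V', hV', hWV'⟩ := hr' W (mem_filter.1 hW).1 (mem_filter.1 hW).2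
        exact hWV'.trans (hτ.subset V' hV')
      · intro x hx
        obtain ⟨W, hW, hxW⟩ := h.cover x (mem_sdiff.1 hx).1
        exact ⟨W, mem_filter.2 ⟨hW, fun hWV => (mem_sdiff.1 hx).2 (hWV hxW)⟩, hxW⟩
    · rintro ⟨P₁, P₂⟩ hx
      simp only [mem_product, mem_filter, mem_ncp] at hx ⊢
      obtain ⟨e₁, e₂⟩ := hsep P₁ P₂ hx.1 hx.2.1 hx.2.2
      rw [e₁, e₂]
    · intro P _
      exact filter_union_filter_not_eq _ P
    · rintro ⟨P₁, P₂⟩ hx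
      simp only [mem_product, mem_filter, mem_ncp] at hx ⊢
      obtain ⟨e₁, e₂⟩ := hsep P₁ P₂ hx.1 hx.2.1 hx.2.2
      rw [prod_union]
      nth_rw 1 [← e₁]
      nth_rw 2 [← e₂]
      exact disjoint_filter_filter_not _ _ _

theorem prod_parts_ncpSum [DecidableLE (NC n)] (K : Finset (Fin n) → R) (π : NC n) :
    ∏ V ∈ π.1.parts, ncpSum K V =
      ∑ σ ∈ (univ : Finset (NC n)).filter (· ≤ π), ∏ W ∈ σ.1.parts, K W := by
  classical
  rw [prod_ncpSum K _ univ (isNCP_parts π)]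
  symm
  refine sum_bij (fun σ _ => σ.1.parts) ?_ ?_ ?_ ?_
  · intro σ hσ
    rw [mem_filter, mem_ncp]
    exact ⟨isNCP_parts σ, fun W hW => (mem_filter.1 hσ).2 hW⟩
  · intro σ _ σ' _ e
    exact Subtype.ext (Finpartition.ext e)
  · intro P hP
    rw [mem_filter, mem_ncp] at hP
    obtain ⟨σ, rfl⟩ := hP.1.exists_nc
    exact ⟨σ, mem_filter.2 ⟨mem_univ _, fun W hW => hP.2 W hW⟩, rfl⟩
  · exact fun _ _ => rfl

/-- Möbius inversion: expand each product of moments into cumulants over the `σ ≤ π`, exchange the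
sums, and use that `μ(π, 1_n)` summed over `[σ, 1_n]` is zero unless `σ = 1_n`. -/
theorem sum_moebOne_mul_prod (hn : 0 < n) (F : Finset (Fin n) → R) (hF : F ∅ = 1) :
    ∑ π : NC n, (π.moebOne : R) * ∏ V ∈ π.1.parts, F V = cumulantOf F univ := by
  classical
  have htop : ∀ π : NC n, π ≤ NC.one n := fun π => le_top (a := π.1)
  -- This needs `0 < n`: for `n = 0` the top partition has no blocks.
  have hparts : (NC.one n).1.parts = {univ} := by
    have : NeZero n := ⟨hn.ne'⟩
    refine subset_antisymm (Finpartition.parts_top_subset _) ?_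
    obtain ⟨V, hV, -⟩ := (NC.one n).1.exists_mem (mem_univ (0 : Fin n))
    obtain rfl : V = univ := mem_singleton.1 (Finpartition.parts_top_subset _ hV)
    exact singleton_subset_iff.2 hV
  have h1 : ∀ π : NC n, ∏ V ∈ π.1.parts, F V =
      ∑ σ ∈ (univ : Finset (NC n)).filter (· ≤ π), ∏ W ∈ σ.1.parts, cumulantOf F W := by
    intro π
    rw [← prod_parts_ncpSum]
    exact prod_congr rfl fun V _ => (ncpSum_cumulantOf F hF V).symm
  simp only [h1, mul_sum, sum_filter, mul_ite, mul_zero]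
  rw [sum_comm]
  have h2 : ∀ σ : NC n, (∑ π : NC n, if σ ≤ π then
      (π.moebOne : R) * ∏ W ∈ σ.1.parts, cumulantOf F W else 0) =
      if σ = NC.one n then ∏ W ∈ σ.1.parts, cumulantOf F W else 0 := by
    intro σ
    have h3 := IncidenceAlgebra.sum_Icc_mu_left (𝕜 := ℤ) σ (NC.one n)
    have h4 : (univ : Finset (NC n)).filter (fun π => σ ≤ π) = Icc σ (NC.one n) := by
      ext π
      simp [htop π]
    rw [← sum_filter, h4, ← sum_mul]
    have h5 : (∑ π ∈ Icc σ (NC.one n), (π.moebOne : R)) = if σ = NC.one n then 1 else 0 := by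
      have := congrArg (Int.cast (R := R)) h3
      push_cast at this
      exact this
    rw [h5, ite_mul, one_mul, zero_mul]
  rw [sum_congr rfl fun σ _ => h2 σ, sum_ite_eq' univ (NC.one n), if_pos (mem_univ _), hparts,
    prod_singleton]

end

/-! ### Switches of a word along a subset -/

theorem Letter.eq_of_ne_of_ne {a b c : Letter} (h : a ≠ b) (h' : c ≠ b) : a = c := by
  cases a <;> cases b <;> cases c <;> simp_all

open Classical in
/-- The pairs `(a, b)` of cyclically consecutive elements of `S` with `ω a ≠ ω b`. -/
noncomputable def switchPairs {n : ℕ} (ω : Fin n → Letter) (S : Finset (Fin n)) :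
    Finset (Fin n × Fin n) :=
  univ.filter fun p => Adjacent S p.1 p.2 ∧ ω p.1 ≠ ω p.2

@[simp] theorem mem_switchPairs {n : ℕ} {ω : Fin n → Letter} {S : Finset (Fin n)}
    {p : Fin n × Fin n} : p ∈ switchPairs ω S ↔ Adjacent S p.1 p.2 ∧ ω p.1 ≠ ω p.2 := by
  simp [switchPairs]

/-- The number of switches of `ω` on going once cyclically around `S`. -/
noncomputable def switchesOn {n : ℕ} (ω : Fin n → Letter) (S : Finset (Fin n)) : ℕ :=
  (switchPairs ω S).card

theorem Adjacent.right_unique {n : ℕ} {S : Finset (Fin n)} {i j k : Fin n} (h : Adjacent S i j)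
    (h' : Adjacent S i k) : j = k := by
  by_contra hne
  have h1 := h.not_between k h'.right_mem
  have h2 := h'.not_between j h.right_mem
  exact h2 ((cyc_or_cyc (Ne.symm h'.ne) (Ne.symm hne) h.ne).resolve_left h1).rotate.rotate

theorem Adjacent.left_unique {n : ℕ} {S : Finset (Fin n)} {i j k : Fin n} (h : Adjacent S i k)
    (h' : Adjacent S j k) : i = j := by
  by_contra hne
  have h1 := h.not_between j h'.left_mem
  have h2 := h'.not_between i h.left_mem
  exact h2 ((cyc_or_cyc (Ne.symm hne) h'.ne h.ne).resolve_left h1).rotate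

theorem Adjacent.eq_finRotate {n : ℕ} {i j : Fin n} (h : Adjacent univ i j) :
    j = finRotate n i := by
  refine h.right_unique ⟨mem_univ _, mem_univ _, fun e => ?_, fun x _ hx => ?_⟩
  · have hi := i.2
    have hj := j.2
    have hne := h.ne
    obtain ⟨m, rfl⟩ : ∃ m, n = m + 1 := ⟨n - 1, by omega⟩
    have := congrArg Fin.val e
    rw [coe_finRotate] at this
    rw [ne_eq, Fin.ext_iff] at hne
    split_ifs at this with h1
    · rw [h1, Fin.val_last] at *
      omega
    · omega
  · have hi := i.2
    have hx' := x.2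
    obtain ⟨m, rfl⟩ : ∃ m, n = m + 1 := ⟨n - 1, by omega⟩
    unfold Cyc at hx
    rw [coe_finRotate] at hx
    split_ifs at hx with h1
    · rw [h1, Fin.val_last] at hx
      omega
    · omega

theorem switchesOn_univ_le {n : ℕ} (ω : Fin n → Letter) : switchesOn ω univ ≤ switchNumber ω := by
  classical
  have h : switchNumber ω = (univ.filter fun i => ω i ≠ ω (finRotate n i)).card := by
    rw [switchNumber, card_filter]
    exact sum_congr rfl fun i _ => by split_ifs <;> simp_all
  rw [h, switchesOn]
  refine card_le_card_of_injOn Prod.fst ?_ ?_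
  · intro p hp
    obtain ⟨h1, h2⟩ := mem_switchPairs.1 hp
    rw [h1.eq_finRotate] at h2
    simpa using h2
  · intro p hp q hq e
    obtain ⟨h1, -⟩ := mem_switchPairs.1 hp
    obtain ⟨h2, -⟩ := mem_switchPairs.1 hq
    exact Prod.ext e (h1.right_unique (e ▸ h2))

theorem not_cyc_self_left {n : ℕ} (a b : Fin n) : ¬ Cyc a a b := by
  unfold Cyc
  omega

theorem not_cyc_self_right {n : ℕ} (a b : Fin n) : ¬ Cyc a b b := by
  unfold Cyc
  omega

/-- Among pairs with different letters, take one with the fewest points of `S` between. Any point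
between would differ in letter from one of the two ends and give a closer pair. -/
theorem exists_switchPair {n : ℕ} {ω : Fin n → Letter} {S : Finset (Fin n)} {a b : Fin n}
    (ha : a ∈ S) (hb : b ∈ S) (hab : ω a ≠ ω b) : (switchPairs ω S).Nonempty := by
  classical
  obtain ⟨⟨i, j⟩, hp, hmin⟩ := exists_min_image ((S ×ˢ S).filter fun p => ω p.1 ≠ ω p.2)
    (fun p => (S.filter fun x => Cyc p.1 x p.2).card) ⟨(a, b), by simp [ha, hb, hab]⟩
  simp only [mem_filter, mem_product] at hp
  refine ⟨(i, j), mem_switchPairs.2 ⟨⟨hp.1.1, hp.1.2, fun e => hp.2 (congrArg ω e), ?_⟩, hp.2⟩⟩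
  intro x hx hcyc
  by_cases h : ω i = ω x
  · have h1 := hmin (x, j) (by simp [hx, hp.1.2, ← h, hp.2])
    refine absurd h1 (not_le.2 (card_lt_card ?_))
    rw [Finset.ssubset_iff_of_subset]
    · exact ⟨x, by simp [hx, hcyc], fun h => not_cyc_self_left _ _ (mem_filter.1 h).2⟩
    · intro y hy
      rw [mem_filter] at hy ⊢
      exact ⟨hy.1, (hcyc.rotate.rotate.trans hy.2.rotate.rotate).rotate⟩
  · have h1 := hmin (i, x) (by simp [hx, hp.1.1, h])
    refine absurd h1 (not_le.2 (card_lt_card ?_))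
    rw [Finset.ssubset_iff_of_subset]
    · exact ⟨x, by simp [hx, hcyc], fun h => not_cyc_self_right _ _ (mem_filter.1 h).2⟩
    · intro y hy
      rw [mem_filter] at hy ⊢
      exact ⟨hy.1, hy.2.trans hcyc⟩

/-- Since `B` does not cross `A`, it lies in a single gap of `A`; as `j ∈ B` directly follows `i` in
the union, that gap starts at `i`. -/
theorem Adjacent.eq_left_of_cyc {n : ℕ} {A B : Finset (Fin n)} {i j a b x : Fin n}
    (hij : Adjacent (A ∪ B) i j) (hi : i ∈ A) (hj : j ∈ B) (hap : Apart A B)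
    (hab : Adjacent A a b) (hx : x ∈ B) (hcyc : Cyc a x b) : a = i := by
  by_contra hne
  have h1 := hap.2 a hab.left_mem b hab.right_mem x hx j hj
  have h2 := hab.not_between i hi
  have h3 := hij.not_between a (mem_union_left _ hab.left_mem)
  have n1 : j ≠ a := fun e => disjoint_left.1 hap.1 hab.left_mem (e ▸ hj)
  have n2 : j ≠ b := fun e => disjoint_left.1 hap.1 hab.right_mem (e ▸ hj)
  have h4 : Cyc a j b := (cyc_or_cyc n1 n2 hab.ne).resolve_right fun h => h1 ⟨hcyc, h⟩
  rcases eq_or_ne i b with rfl | hib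
  · exact h3 h4.rotate.rotate
  · have h5 := (cyc_or_cyc (Ne.symm hne) hib hab.ne).resolve_left h2
    exact h3 (h4.trans h5.rotate.rotate).rotate.rotate

theorem Adjacent.eq_right_of_cyc {n : ℕ} {A B : Finset (Fin n)} {i j a b x : Fin n}
    (hij : Adjacent (A ∪ B) i j) (hi : i ∈ A) (hj : j ∈ B) (hap : Apart A B)
    (hab : Adjacent B a b) (hx : x ∈ A) (hcyc : Cyc a x b) : b = j := by
  by_contra hne
  have h1 := hap.symm.2 a hab.left_mem b hab.right_mem x hx i hi
  have h2 := hab.not_between j hj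
  have h3 := hij.not_between b (mem_union_right _ hab.right_mem)
  have n1 : i ≠ a := fun e => disjoint_left.1 hap.1 hi (e ▸ hab.left_mem)
  have n2 : i ≠ b := fun e => disjoint_left.1 hap.1 hi (e ▸ hab.right_mem)
  have h4 : Cyc a i b := (cyc_or_cyc n1 n2 hab.ne).resolve_right fun h => h1 ⟨hcyc, h⟩
  rcases eq_or_ne j a with rfl | hja
  · exact h3 h4.rotate
  · have h5 := (cyc_or_cyc hja (Ne.symm hne) hab.ne).resolve_left h2
    exact h3 (h4.trans' h5.rotate.rotate)

/-- All of `B` lies in the gap of `A` from `i` to `p`, and all of `A` in the gap of `B` from `q` to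
`j`. Hence `q` is the last point of `B` met before returning to `A` at `p`. -/
theorem Adjacent.union_of_gaps {n : ℕ} {A B : Finset (Fin n)} {i j p q y z : Fin n}
    (hap : Apart A B) (hip : Adjacent A i p) (hqj : Adjacent B q j)
    (hy : y ∈ B) (hyc : Cyc i y p) (hz : z ∈ A) (hzc : Cyc q z j) : Adjacent (A ∪ B) q p := by
  have hdisj : ∀ a ∈ A, ∀ b ∈ B, a ≠ b := fun a ha b hb e =>
    disjoint_left.1 hap.1 ha (e ▸ hb)
  have hB : ∀ x ∈ B, Cyc i x p := fun x hx =>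
    (cyc_or_cyc (hdisj i hip.left_mem x hx).symm (hdisj p hip.right_mem x hx).symm
      hip.ne).resolve_right
      fun h => hap.2 i hip.left_mem p hip.right_mem y hy x hx ⟨hyc, h⟩
  have hA : ∀ x ∈ A, Cyc q x j := fun x hx =>
    (cyc_or_cyc (hdisj x hx q hqj.left_mem) (hdisj x hx j hqj.right_mem) hqj.ne).resolve_right
      fun h => hap.symm.2 q hqj.left_mem j hqj.right_mem z hz x hx ⟨hzc, h⟩
  refine ⟨mem_union_right _ hqj.left_mem, mem_union_left _ hip.right_mem,
    (hdisj p hip.right_mem q hqj.left_mem).symm, fun x hx hc => ?_⟩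
  rcases mem_union.1 hx with hx | hx
  · exact hip.not_between x hx
      ((hB q hqj.left_mem).rotate.rotate.trans hc.rotate.rotate).rotate
  · exact hqj.not_between x hx (hc.trans (hA p hip.right_mem))

/-- A switch of `A` or `B` that is not one of the union bridges the gap holding the other block, so
each block has at most one. They are paid for by the switches of the union that pass between the
blocks. One of these is `(i, j)`; if both blocks have a bridging switch, the other crossing between
them is a switch too. -/
theorem switchesOn_add_le {n : ℕ} {ω : Fin n → Letter} {A B : Finset (Fin n)} {i j : Fin n}
    (hij : Adjacent (A ∪ B) i j) (hω : ω i ≠ ω j) (hi : i ∈ A) (hj : j ∈ B) (hap : Apart A B) :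
    switchesOn ω A + switchesOn ω B ≤ switchesOn ω (A ∪ B) := by
  classical
  have hdisj : ∀ a ∈ A, a ∉ B := fun a ha hb => disjoint_left.1 hap.1 ha hb
  set P := switchPairs ω (A ∪ B) with hP
  set EA := switchPairs ω A \ P with hEA
  set EB := switchPairs ω B \ P with hEB
  set M := P.filter fun p => ¬ (p.1 ∈ A ∧ p.2 ∈ A) ∧ ¬ (p.1 ∈ B ∧ p.2 ∈ B) with hM
  have hgapA : ∀ p ∈ EA, p.1 = i ∧ ∃ y ∈ B, Cyc p.1 y p.2 := by
    intro p hp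
    obtain ⟨h1, h2⟩ := mem_sdiff.1 hp
    rw [mem_switchPairs] at h1
    have : ∃ y ∈ B, Cyc p.1 y p.2 := by
      by_contra! hno
      refine h2 (mem_switchPairs.2 ⟨⟨mem_union_left _ h1.1.left_mem,
        mem_union_left _ h1.1.right_mem, h1.1.ne, fun x hx => ?_⟩, h1.2⟩)
      rcases mem_union.1 hx with hx | hx
      exacts [h1.1.not_between x hx, hno x hx]
    obtain ⟨y, hy, hc⟩ := this
    exact ⟨hij.eq_left_of_cyc hi hj hap h1.1 hy hc, y, hy, hc⟩
  have hgapB : ∀ p ∈ EB, p.2 = j ∧ ∃ y ∈ A, Cyc p.1 y p.2 := by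
    intro p hp
    obtain ⟨h1, h2⟩ := mem_sdiff.1 hp
    rw [mem_switchPairs] at h1
    have : ∃ y ∈ A, Cyc p.1 y p.2 := by
      by_contra! hno
      refine h2 (mem_switchPairs.2 ⟨⟨mem_union_right _ h1.1.left_mem,
        mem_union_right _ h1.1.right_mem, h1.1.ne, fun x hx => ?_⟩, h1.2⟩)
      rcases mem_union.1 hx with hx | hx
      exacts [hno x hx, h1.1.not_between x hx]
    obtain ⟨y, hy, hc⟩ := this
    exact ⟨hij.eq_right_of_cyc hi hj hap h1.1 hy hc, y, hy, hc⟩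
  have hA1 : EA.card ≤ 1 := card_le_one.2 fun p hp q hq => by
    have h1 := (mem_switchPairs.1 (mem_sdiff.1 hp).1).1
    have h2 := (mem_switchPairs.1 (mem_sdiff.1 hq).1).1
    have e : p.1 = q.1 := (hgapA p hp).1.trans (hgapA q hq).1.symm
    exact Prod.ext e (h1.right_unique (e ▸ h2))
  have hB1 : EB.card ≤ 1 := card_le_one.2 fun p hp q hq => by
    have h1 := (mem_switchPairs.1 (mem_sdiff.1 hp).1).1
    have h2 := (mem_switchPairs.1 (mem_sdiff.1 hq).1).1
    have e : p.2 = q.2 := (hgapB p hp).1.trans (hgapB q hq).1.symm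
    exact Prod.ext (h1.left_unique (e ▸ h2)) e
  have hijM : (i, j) ∈ M := mem_filter.2
    ⟨mem_switchPairs.2 ⟨hij, hω⟩, fun h => hdisj j h.2 hj, fun h => hdisj i hi h.1⟩
  have hM1 : 1 ≤ M.card := card_pos.2 ⟨_, hijM⟩
  have hEM : EA.card + EB.card ≤ M.card := by
    rcases EA.eq_empty_or_nonempty with h0 | ⟨⟨i', p⟩, hp⟩
    · rw [h0, card_empty]; omega
    rcases EB.eq_empty_or_nonempty with h0 | ⟨⟨q, j'⟩, hq⟩
    · rw [h0, card_empty]; omega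
    obtain ⟨hi', y, hy, hyc⟩ := hgapA _ hp
    obtain ⟨hj', z, hz, hzc⟩ := hgapB _ hq
    simp only at hi' hj' hyc hzc
    subst hi' hj'
    obtain ⟨h1, hω1⟩ := mem_switchPairs.1 (mem_sdiff.1 hp).1
    obtain ⟨h2, hω2⟩ := mem_switchPairs.1 (mem_sdiff.1 hq).1
    simp only at h1 h2 hω1 hω2
    have hqp : (q, p) ∈ M := mem_filter.2 ⟨mem_switchPairs.2
      ⟨Adjacent.union_of_gaps hap h1 h2 hy hyc hz hzc, fun e => ?_⟩,
      fun h => hdisj q h.1 h2.left_mem, fun h => hdisj p h1.right_mem h.2⟩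
    · have : 1 < M.card := one_lt_card.2 ⟨_, hijM, _, hqp, fun e => hdisj i' hi (by
        rw [(Prod.mk.inj e).1]; exact h2.left_mem)⟩
      omega
    · simp only at e
      -- There are only two letters: both `i` and `q` differ from `j`, so `ω q = ω i`, which differs
      -- from `ω p`.
      exact hω1 ((Letter.eq_of_ne_of_ne hω hω2).trans e)
  have hsplit : (switchPairs ω A ∩ P).card + (switchPairs ω B ∩ P).card + M.card ≤ P.card := by
    rw [← card_union_of_disjoint, ← card_union_of_disjoint]
    · exact card_le_card (union_subset (union_subset inter_subset_right inter_subset_right)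
        (filter_subset _ _))
    · refine disjoint_left.2 fun p hp hpM => ?_
      have h := (mem_filter.1 hpM).2
      rcases mem_union.1 hp with hp | hp
      · have := (mem_switchPairs.1 (mem_inter.1 hp).1).1
        exact h.1 ⟨this.left_mem, this.right_mem⟩
      · have := (mem_switchPairs.1 (mem_inter.1 hp).1).1
        exact h.2 ⟨this.left_mem, this.right_mem⟩
    · refine disjoint_left.2 fun p hp hp' => ?_
      have h1 := (mem_switchPairs.1 (mem_inter.1 hp).1).1
      have h2 := (mem_switchPairs.1 (mem_inter.1 hp').1).1
      exact hdisj _ h1.left_mem h2.left_mem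
  have h1 := card_inter_add_card_sdiff (switchPairs ω A) P
  have h2 := card_inter_add_card_sdiff (switchPairs ω B) P
  rw [← hEA] at h1
  rw [← hEB] at h2
  rw [switchesOn, switchesOn, switchesOn, ← hP]
  omega

/-! ### Cumulants of words in a formal unitary and its inverse -/

/-- The exponents of `u^1 = u` and `u^* = u⁻¹`. -/
def Letter.exponent : Letter → ℤ
  | Letter.one => 1
  | Letter.star => -1

/-- The exponent of `u` in the subword of `ω` on `S`. -/
def netExponent {n : ℕ} (ω : Fin n → Letter) (S : Finset (Fin n)) : ℤ :=
  ∑ i ∈ S, (ω i).exponent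

theorem netExponent_sdiff_pair {n : ℕ} {ω : Fin n → Letter} {S : Finset (Fin n)} {i j : Fin n}
    (hi : i ∈ S) (hj : j ∈ S) (hω : ω i ≠ ω j) :
    netExponent ω S = netExponent ω (S \ {i, j}) := by
  have hij : i ≠ j := fun e => hω (congrArg ω e)
  have hsub : ({i, j} : Finset (Fin n)) ⊆ S := by simp [insert_subset_iff, hi, hj]
  have h0 : (ω i).exponent + (ω j).exponent = 0 := by
    cases h : ω i <;> cases h' : ω j <;> simp_all [Letter.exponent]
  rw [netExponent, netExponent, ← sum_sdiff hsub, sum_pair hij, h0, add_zero]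

theorem exists_natAbs_netExponent {n : ℕ} (ω : Fin n → Letter) (S : Finset (Fin n)) :
    ∃ j, (netExponent ω S).natAbs + 2 * j = S.card := by
  classical
  have h : ∃ k l : ℕ, netExponent ω S = k - l ∧ k + l = S.card := by
    induction S using Finset.induction_on with
    | empty => exact ⟨0, 0, by simp [netExponent]⟩
    | insert a S ha ih =>
      obtain ⟨k, l, h1, h2⟩ := ih
      rw [netExponent] at h1
      rw [netExponent, sum_insert ha, card_insert_of_notMem ha, h1]
      cases ω a
      · exact ⟨k + 1, l, by simp only [Letter.exponent]; push_cast; ring, by omega⟩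
      · exact ⟨k, l + 1, by simp only [Letter.exponent]; push_cast; ring, by omega⟩
  obtain ⟨k, l, h1, h2⟩ := h
  -- With `k` letters `1` and `l` letters `*`, one has `|k - l| + 2 min(k, l) = k + l`.
  exact ⟨min k l, by omega⟩

theorem natAbs_netExponent_of_constant {n : ℕ} {ω : Fin n → Letter} {S : Finset (Fin n)}
    (h : ∀ a ∈ S, ∀ b ∈ S, ω a = ω b) : (netExponent ω S).natAbs = S.card := by
  rcases S.eq_empty_or_nonempty with rfl | ⟨x, hx⟩
  · simp [netExponent]
  · rw [netExponent, sum_congr rfl fun a ha => congrArg Letter.exponent (h a ha x hx), sum_const,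
      nsmul_eq_mul, Int.natAbs_mul]
    cases ω x <;> simp [Letter.exponent]

theorem two_le_switchesOn_pair {n : ℕ} {ω : Fin n → Letter} {i j : Fin n} (hω : ω i ≠ ω j) :
    2 ≤ switchesOn ω {i, j} := by
  have hij : i ≠ j := fun e => hω (congrArg ω e)
  have hadj : ∀ a b : Fin n, a ≠ b → Adjacent {a, b} a b := fun a b hab =>
    ⟨by simp, by simp, hab, fun x hx => by
      rcases mem_insert.1 hx with rfl | hx
      · exact not_cyc_self_left _ _
      · rw [mem_singleton.1 hx]
        exact not_cyc_self_right _ _⟩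
  refine one_lt_card.2 ⟨(i, j), mem_switchPairs.2 ⟨hadj i j hij, hω⟩, (j, i),
    mem_switchPairs.2 ⟨?_, hω.symm⟩, fun e => hij (Prod.mk.inj e).1⟩
  rw [pair_comm]
  exact hadj j i hij.symm

theorem switchesOn_eq_zero {n : ℕ} {ω : Fin n → Letter} {S : Finset (Fin n)}
    (h : ∀ a ∈ S, ∀ b ∈ S, ω a = ω b) : switchesOn ω S = 0 := by
  refine card_eq_zero.2 (eq_empty_of_forall_notMem fun p hp => ?_)
  obtain ⟨h1, h2⟩ := mem_switchPairs.1 hp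
  exact h2 (h _ h1.left_mem _ h1.right_mem)

section

variable {R : Type*} [CommRing R] {n : ℕ}

/-- The moments of the subwords of `ω` when the `k`-th power of `u` and of its inverse have
moment `c k * y ^ k`. -/
def wordMoment (c : ℕ → R) (y : R) (ω : Fin n → Letter) (S : Finset (Fin n)) : R :=
  c (netExponent ω S).natAbs * y ^ (netExponent ω S).natAbs

theorem pow_dvd_cumulantOf_wordMoment (c : ℕ → R) (hc : c 0 = 1) (y : R) (ω : Fin n → Letter)
    (S : Finset (Fin n)) :
    y ^ (S.card - switchesOn ω S) ∣ cumulantOf (wordMoment c y ω) S := by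
  classical
  induction S using Finset.strongInduction with
  | H S ih =>
    have hF : wordMoment c y ω ∅ = 1 := by simp [wordMoment, netExponent, hc]
    by_cases hconst : ∀ a ∈ S, ∀ b ∈ S, ω a = ω b
    · rw [switchesOn_eq_zero hconst, Nat.sub_zero, cumulantOf_eq]
      refine dvd_sub ?_ (dvd_sum fun P hP => ?_)
      · rw [wordMoment, natAbs_netExponent_of_constant hconst]
        exact dvd_mul_left _ _
      · rw [mem_erase, mem_ncp] at hP
        obtain ⟨hne, hP⟩ := hP
        rw [card_eq_sum_of_isNCP hP, ← prod_pow_eq_pow_sum]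
        refine prod_dvd_prod_of_dvd _ _ fun V hV => ?_
        have hVS := hP.subset V hV
        have h := ih V (Finset.ssubset_iff_subset_ne.2
          ⟨hVS, fun e => hne (hP.eq_singleton (by rwa [e] at hV))⟩)
        rwa [switchesOn_eq_zero fun a ha b hb => hconst a (hVS ha) b (hVS hb),
          Nat.sub_zero] at h
    · push Not at hconst
      obtain ⟨a, ha, b, hb, hab⟩ := hconst
      obtain ⟨⟨i, j⟩, hp⟩ := exists_switchPair ha hb hab
      obtain ⟨hadj, hω⟩ := mem_switchPairs.1 hp
      simp only at hadj hω
      -- The pair has at least two switches and at most two points, so the required power is `y^0`.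
      rcases eq_or_ne S {i, j} with rfl | hS
      · have h2 := two_le_switchesOn_pair hω
        have h3 : ({i, j} : Finset (Fin n)).card ≤ 2 := card_le_two
        rw [Nat.sub_eq_zero_of_le (h3.trans h2), pow_zero]
        exact one_dvd _
      · have h := mergedCumulant_cumulantOf (wordMoment c y ω) hF
          (fun T hi hj => by rw [wordMoment, wordMoment, netExponent_sdiff_pair hi hj hω]) S hadj
        rw [if_neg hS, mergedCumulant] at h
        rw [eq_neg_of_add_eq_zero_left h, dvd_neg]
        refine dvd_sum fun A hA => ?_
        simp only [mem_filter, mem_powerset] at hA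
        obtain ⟨hAS, hiA, hjA, hap⟩ := hA
        have hU : A ∪ (S \ A) = S := union_sdiff_of_subset hAS
        have hle := switchesOn_add_le (hU.symm ▸ hadj) hω hiA
          (mem_sdiff.2 ⟨hadj.right_mem, hjA⟩) hap
        rw [hU] at hle
        have hcard : (S \ A).card + A.card = S.card := card_sdiff_add_card_eq_card hAS
        have h1 := ih A (Finset.ssubset_iff_subset_ne.2
          ⟨hAS, fun e => hjA (e ▸ hadj.right_mem)⟩)
        have h2 := ih (S \ A) (Finset.ssubset_iff_subset_ne.2
          ⟨sdiff_subset, fun e => (mem_sdiff.1 (e.symm ▸ hadj.left_mem)).2 hiA⟩)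
        -- Sizes add up and switches of the parts total at most those of `S`; truncation of the
        -- subtractions can only raise the exponent available from the two parts.
        refine (pow_dvd_pow y ?_).trans ((pow_add y _ _).symm ▸ mul_dvd_mul h1 h2)
        omega

end

/-! ### Moments of the free unitary Brownian motion -/

/-- The coefficients, as polynomials in `t`, of the series `z e^{tz} / (1 + z)`. -/
noncomputable def inverseMomentCoeff : ℕ → ℚ[X]
  | 0 => 0
  | k + 1 => Polynomial.C (1 / (k.factorial : ℚ)) * Polynomial.X ^ k - inverseMomentCoeff k

/-- The series `z e^{tz} / (1 + z)` with coefficients in `ℚ[t]`. -/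
noncomputable def inverseMomentSeries : PowerSeries ℚ[X] := PowerSeries.mk inverseMomentCoeff

/-- The moments of `e^{t/2} u_t` as polynomials in `t`. -/
noncomputable def momentPoly : ℕ → ℚ[X]
  | 0 => 1
  | n + 1 => (if n = 0 then 1 else 0) -
      ∑ k : Fin n, momentPoly (k + 1) * PowerSeries.coeff (n + 1) (inverseMomentSeries ^ (k.1 + 1))

theorem eq_map_inverseMomentSeries {t : ℂ} {χ : PowerSeries ℂ}
    (h0 : PowerSeries.constantCoeff χ = 0)
    (h : PowerSeries.X * PowerSeries.rescale t (PowerSeries.exp ℂ) = (1 + PowerSeries.X) * χ) :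
    χ = PowerSeries.map (Polynomial.aeval t : ℚ[X] →ₐ[ℚ] ℂ).toRingHom inverseMomentSeries := by
  ext k
  rw [PowerSeries.coeff_map, inverseMomentSeries, PowerSeries.coeff_mk]
  induction k with
  | zero => simpa [inverseMomentCoeff] using h0
  | succ k ih =>
    have h1 := congrArg (PowerSeries.coeff (k + 1)) h
    rw [PowerSeries.coeff_succ_X_mul, add_mul, one_mul, map_add, PowerSeries.coeff_succ_X_mul,
      PowerSeries.coeff_rescale, PowerSeries.coeff_exp, ih] at h1
    rw [← sub_eq_iff_eq_add] at h1
    rw [← h1, inverseMomentCoeff]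
    simp
    ring

/-- The coefficient of `z^{n+1}` in `M(χ(z)) = z` determines the moment of order `n + 1` from the
lower ones, because `χ` has leading term `z` and so `χ^{n+1}` has leading coefficient 1. -/
theorem moment_eq_aeval_momentPoly {A : Type*} [Ring A] [Algebra ℂ A] (φ : A →ₗ[ℂ] ℂ)
    (h1 : φ 1 = 1) {a : A} {t : ℂ}
    (h : HasSTransform φ a (PowerSeries.rescale t (PowerSeries.exp ℂ))) (n : ℕ) :
    φ (a ^ n) = Polynomial.aeval t (momentPoly n) := by
  obtain ⟨χ, h0, hχ, -, hS⟩ := h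
  have hχm := eq_map_inverseMomentSeries h0 hS
  have hX : PowerSeries.X ∣ χ := PowerSeries.X_dvd_iff.2 h0
  have hcoef : ∀ m d : ℕ, PowerSeries.coeff m (χ ^ d) =
      Polynomial.aeval t (PowerSeries.coeff m (inverseMomentSeries ^ d)) := by
    intro m d
    rw [hχm, ← map_pow, PowerSeries.coeff_map]
    rfl
  have hlt : ∀ m d : ℕ, m < d → PowerSeries.coeff m (χ ^ d) = 0 := fun m d hmd =>
    PowerSeries.X_pow_dvd_iff.1 (pow_dvd_pow_of_dvd hX d) m hmd
  have hself : ∀ d : ℕ, PowerSeries.coeff d (χ ^ d) = 1 := by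
    obtain ⟨ψ, hψ⟩ := hX
    have hc : PowerSeries.coeff 0 ψ = 1 := by
      have h2 : PowerSeries.coeff 1 χ = 1 := by
        rw [hχm, PowerSeries.coeff_map, inverseMomentSeries, PowerSeries.coeff_mk]
        simp [inverseMomentCoeff]
      rwa [hψ, PowerSeries.coeff_succ_X_mul] at h2
    intro d
    have h3 := PowerSeries.coeff_X_pow_mul (ψ ^ d) d 0
    rw [zero_add] at h3
    rw [hψ, mul_pow, h3, PowerSeries.coeff_zero_eq_constantCoeff, map_pow,
      ← PowerSeries.coeff_zero_eq_constantCoeff_apply, hc, one_pow]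
  induction n using Nat.strong_induction_on with
  | _ n ih =>
    cases n with
    | zero => simp [momentPoly, h1]
    | succ n =>
      have h4 := congrArg (PowerSeries.coeff (n + 1)) hχ
      rw [PowerSeries.coeff_subst' (PowerSeries.HasSubst.of_constantCoeff_zero' h0),
        finsum_eq_sum_of_support_subset (s := range (n + 2))] at h4
      · rw [sum_range_succ', sum_range_succ] at h4
        simp only [momentSeries, PowerSeries.coeff_mk, PowerSeries.coeff_X, smul_eq_mul, hself,
          if_true, zero_mul, add_zero, Nat.succ_ne_zero, if_false, mul_one] at h4
        rw [momentPoly, map_sub, map_sum, Fin.sum_univ_eq_sum_range (fun k =>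
          Polynomial.aeval t (momentPoly (k + 1) *
            PowerSeries.coeff (n + 1) (inverseMomentSeries ^ (k + 1)))) n]
        rw [← eq_sub_iff_add_eq'] at h4
        rw [h4]
        congr 1
        · by_cases hn : n = 0 <;> simp [hn]
        · refine sum_congr rfl fun k hk => ?_
          rw [ih (k + 1) (by have := mem_range.1 hk; omega), hcoef, map_mul]
      · intro d hd
        rw [mem_coe, mem_range]
        by_contra hlt'
        exact hd (by simp only [hlt (n + 1) d (by omega), smul_zero])

/-- Polarization: `φ(b* b)` is real for `b = 1 + z a`, so `z φ(a) + z̄ φ(a*)` is real; `z = 1` and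
`z = i` suffice. -/
theorem TracialStarProbSpace.map_star (T : TracialStarProbSpace.{u}) (a : T.carrier) :
    T.φ (star a) = star (T.φ a) := by
  have him : ∀ b : T.carrier, (T.φ (star b * b)).im = 0 := fun b =>
    (Complex.le_def.1 (T.nonneg b)).2.symm
  have key : ∀ z : ℂ, (z * T.φ a + star z * T.φ (star a)).im = 0 := by
    intro z
    have h := him (1 + z • a)
    have hexp : star (1 + z • a) * (1 + z • a) =
        1 + z • a + star z • star a + (star z * z) • (star a * a) := by
      simp only [star_add, star_one, star_smul, add_mul, mul_add, one_mul, mul_one,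
        smul_mul_smul_comm]
      abel
    rw [hexp, map_add, map_add, map_add, T.map_one, map_smul, map_smul, map_smul] at h
    have h2 : star z * z = ((Complex.normSq z : ℝ) : ℂ) := by
      rw [mul_comm]; exact Complex.mul_conj z
    simp only [smul_eq_mul, h2, Complex.add_im, Complex.one_im, Complex.im_ofReal_mul, him,
      mul_zero, add_zero, zero_add] at h
    rw [Complex.add_im]
    exact h
  have k1 := key 1
  have k2 := key Complex.I
  simp at k1 k2
  apply Complex.ext <;> simp <;> linarith

/-- The elements `u^1` and `u^*` as powers of the unitary `u`. -/
theorem Letter.act_eq_zpow {A : Type*} [Ring A] [StarRing A] (u : unitary A) (l : Letter) :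
    l.act (u : A) = ((u ^ l.exponent : unitary A) : A) := by
  cases l
  · simp [Letter.act, Letter.exponent]
  · rw [Letter.exponent, zpow_neg_one]
    rfl

theorem prod_map_act {A : Type*} [Ring A] [StarRing A] (u : unitary A) {n : ℕ}
    (ω : Fin n → Letter) (L : List (Fin n)) :
    (L.map fun i => (ω i).act (u : A)).prod =
      ((u ^ (L.map fun i => (ω i).exponent).sum : unitary A) : A) := by
  induction L with
  | nil => simp
  | cons i L ih =>
    rw [List.map_cons, List.prod_cons, ih, Letter.act_eq_zpow, List.map_cons, List.sum_cons,
      zpow_add, Submonoid.coe_mul]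

theorem FreeUnitaryBrownianMotion.moment_zpow (U : FreeUnitaryBrownianMotion.{u}) (t : ℝ≥0)
    (k : ℤ) :
    (U.space t).φ (((⟨U.elem t, U.unitary t⟩ : _root_.unitary (U.space t).carrier) ^ k :
      _root_.unitary (U.space t).carrier) : (U.space t).carrier) =
      Polynomial.aeval ((t : ℝ) : ℂ) (momentPoly k.natAbs) *
        (Real.exp (-(t : ℝ) / 2) : ℂ) ^ k.natAbs := by
  have hnat : ∀ m : ℕ, (U.space t).φ (U.elem t ^ m) =
      Polynomial.aeval ((t : ℝ) : ℂ) (momentPoly m) * (Real.exp (-(t : ℝ) / 2) : ℂ) ^ m := by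
    intro m
    have h := moment_eq_aeval_momentPoly (U.space t).φ (U.space t).map_one (U.sTransform t) m
    rw [smul_pow, map_smul, smul_eq_mul] at h
    rw [← h, mul_right_comm, ← mul_pow, ← Complex.ofReal_mul, ← Real.exp_add]
    ring_nf
    simp
  -- The moments of positive powers are real, so taking adjoints gives the same values for negative
  -- powers.
  have hreal : ∀ m : ℕ, star (Polynomial.aeval ((t : ℝ) : ℂ) (momentPoly m) *
      (Real.exp (-(t : ℝ) / 2) : ℂ) ^ m) = Polynomial.aeval ((t : ℝ) : ℂ) (momentPoly m) *
      (Real.exp (-(t : ℝ) / 2) : ℂ) ^ m := by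
    intro m
    have h2 : Polynomial.aeval ((t : ℝ) : ℂ) (momentPoly m) =
        ((Polynomial.aeval (t : ℝ) (momentPoly m) : ℝ) : ℂ) :=
      Polynomial.aeval_algebraMap_apply ℂ (t : ℝ) (momentPoly m)
    rw [h2, ← Complex.ofReal_pow, ← Complex.ofReal_mul]
    exact Complex.conj_ofReal _
  obtain ⟨m, rfl | rfl⟩ := k.eq_nat_or_neg
  · rw [zpow_natCast, Int.natAbs_natCast, SubmonoidClass.coe_pow, hnat]
  · rw [zpow_neg, zpow_natCast, Int.natAbs_neg, Int.natAbs_natCast, ← hreal, ← hnat,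
      ← TracialStarProbSpace.map_star, ← Unitary.star_eq_inv, Unitary.coe_star,
      SubmonoidClass.coe_pow]

theorem FreeUnitaryBrownianMotion.restrictedMoment_eq (U : FreeUnitaryBrownianMotion.{u})
    (t : ℝ≥0) {n : ℕ} (ω : Fin n → Letter) (V : Finset (Fin n)) :
    restrictedMoment (U.space t).φ (fun i => (ω i).act (U.elem t)) V =
      evalXY (wordMoment (fun k => Polynomial.C (momentPoly k)) Polynomial.X ω V)
        ((t : ℝ) : ℂ) (Real.exp (-(t : ℝ) / 2) : ℂ) := by
  have hsum : ((V.sort).map fun i => (ω i).exponent).sum = netExponent ω V := by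
    rw [netExponent, Finset.sum, ← Finset.sort_eq V (· ≤ ·), Multiset.map_coe, Multiset.sum_coe]
  rw [restrictedMoment, prod_map_act ⟨U.elem t, U.unitary t⟩ ω, hsum, U.moment_zpow, evalXY,
    wordMoment, map_mul, map_pow]
  simp

/-! ### The functions `t` and `e^{-t/2}` are algebraically independent -/

section

open Filter Topology

theorem tendsto_exp_neg_half : Tendsto (fun t : ℝ => Real.exp (-t / 2)) atTop (𝓝 0) := by
  refine Real.tendsto_exp_atBot.comp ?_
  simp only [neg_div]
  exact tendsto_neg_atTop_atBot.comp (tendsto_id.atTop_div_const two_pos)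

theorem tendsto_exp_neg_half_mul_aeval (p : ℚ[X]) :
    Tendsto (fun t : ℝ => Real.exp (-t / 2) * Polynomial.aeval t p) atTop (𝓝 0) := by
  -- With `s = t / 2` this is the limit of the polynomial `p(2s)` divided by `e^s`.
  have h := ((p.map (algebraMap ℚ ℝ)).comp
    (Polynomial.C 2 * Polynomial.X)).tendsto_div_exp_atTop.comp
    (tendsto_id.atTop_div_const (two_pos : (0 : ℝ) < 2))
  refine h.congr fun t => ?_
  have h2 : (2 : ℝ) * (t / 2) = t := by ring
  simp only [Function.comp, id, Polynomial.eval_comp, Polynomial.eval_mul, Polynomial.eval_C,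
    Polynomial.eval_X, h2, neg_div, Real.exp_neg, Polynomial.aeval_def, Polynomial.eval₂_eq_eval_map]
  rw [div_eq_inv_mul]

theorem tendsto_exp_neg_half_mul_aevalAeval (E : ℚ[X][Y]) :
    Tendsto (fun t : ℝ => Real.exp (-t / 2) *
      Polynomial.aevalAeval t (Real.exp (-t / 2)) E) atTop (𝓝 0) := by
  induction E using Polynomial.induction_on with
  | C a => simpa using tendsto_exp_neg_half_mul_aeval a
  | add p q hp hq =>
    have h := hp.add hq
    rw [add_zero] at h
    exact h.congr fun t => by rw [map_add, mul_add]
  | monomial k a ih =>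
    have h := ih.mul tendsto_exp_neg_half
    rw [zero_mul] at h
    exact h.congr fun t => by rw [pow_succ, ← mul_assoc, map_mul _ _ Polynomial.X]; simp [mul_assoc]

/-- The relation expresses the coefficient of `y^0`, a polynomial in `t`, as a multiple of
`e^{-t/2}` that tends to 0; a polynomial with limit 0 at infinity is zero. -/
theorem coeff_zero_eq_zero_of_aevalAeval (D : ℚ[X][Y])
    (h : ∀ t : ℝ, 0 ≤ t → Polynomial.aevalAeval t (Real.exp (-t / 2)) D = 0) :
    D.coeff 0 = 0 := by
  have h1 : Tendsto (fun t : ℝ => ((D.coeff 0).map (algebraMap ℚ ℝ)).eval t) atTop (𝓝 0) := by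
    have h2 := (tendsto_exp_neg_half_mul_aevalAeval D.divX).neg
    rw [neg_zero] at h2
    refine h2.congr' ?_
    filter_upwards [eventually_ge_atTop 0] with t ht
    have h3 := h t ht
    rw [← Polynomial.divX_mul_X_add D] at h3
    rw [map_add, map_mul, Polynomial.aevalAeval_C] at h3
    rw [← Polynomial.eval₂_eq_eval_map, ← Polynomial.aeval_def]
    have h4 : Polynomial.aevalAeval t (Real.exp (-t / 2)) (Polynomial.X : ℚ[X][Y]) =
      Real.exp (-t / 2) := by simp
    rw [h4] at h3
    linarith
  have h2 := (Polynomial.tendsto_nhds_iff _).1 h1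
  rw [Polynomial.leadingCoeff_eq_zero] at h2
  exact (Polynomial.map_eq_zero_iff (algebraMap ℚ ℝ).injective).1 h2.1

theorem eq_zero_of_aevalAeval (D : ℚ[X][Y])
    (h : ∀ t : ℝ, 0 ≤ t → Polynomial.aevalAeval t (Real.exp (-t / 2)) D = 0) : D = 0 := by
  ext1 k
  rw [Polynomial.coeff_zero]
  induction k generalizing D with
  | zero => exact coeff_zero_eq_zero_of_aevalAeval D h
  | succ k ih =>
    -- The constant term vanishes and `e^{-t/2}` is never 0, so `y` can be divided out.
    rw [← Polynomial.coeff_divX]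
    refine ih D.divX fun t ht => ?_
    have h3 := h t ht
    rw [← Polynomial.divX_mul_X_add D, coeff_zero_eq_zero_of_aevalAeval D h, map_zero, add_zero,
      map_mul] at h3
    refine (mul_eq_zero.1 h3).resolve_right ?_
    simp

theorem evalXY_ofReal (D : ℚ[X][Y]) (x y : ℝ) :
    evalXY D (x : ℂ) (y : ℂ) = ((Polynomial.aevalAeval x y D : ℝ) : ℂ) := by
  rw [evalXY]
  induction D using Polynomial.induction_on with
  | C a =>
    rw [Polynomial.aevalAeval_C, Polynomial.aevalAeval_C]
    exact Polynomial.aeval_algebraMap_apply ℂ x a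
  | add p q hp hq => rw [map_add, map_add, hp, hq, Complex.ofReal_add]
  | monomial k a ih =>
    rw [pow_succ, ← mul_assoc, map_mul _ _ Polynomial.X, map_mul _ _ Polynomial.X, ih]
    simp

theorem RepresentsCumulants.unique {U : FreeUnitaryBrownianMotion.{u}} {n : ℕ}
    {ω : Fin n → Letter} {Z Z' : ℚ[X][Y]} (h : RepresentsCumulants U ω Z)
    (h' : RepresentsCumulants U ω Z') : Z' = Z := by
  rw [← sub_eq_zero]
  refine eq_zero_of_aevalAeval _ fun t ht => ?_
  have e := (h' ⟨t, ht⟩).symm.trans (h ⟨t, ht⟩)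
  rw [evalXY_ofReal, evalXY_ofReal, Complex.ofReal_inj] at e
  rw [map_sub, sub_eq_zero]
  exact e

end

/-! ### The polynomials representing the free cumulants -/

/-- The free cumulant of the word `ω` as a polynomial in `t` and `e^{-t/2}`. -/
noncomputable def cumulantPoly {n : ℕ} (ω : Fin n → Letter) : ℚ[X][Y] :=
  ∑ π : NC n, (π.moebOne : ℚ[X][Y]) *
    ∏ V ∈ π.1.parts, wordMoment (fun k => Polynomial.C (momentPoly k)) Polynomial.X ω V

theorem representsCumulants_cumulantPoly (U : FreeUnitaryBrownianMotion.{u}) {n : ℕ}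
    (ω : Fin n → Letter) : RepresentsCumulants U ω (cumulantPoly ω) := by
  intro t
  rw [FreeUnitaryBrownianMotion.cumulant, freeCumulant, cumulantPoly, evalXY, map_sum]
  refine sum_congr rfl fun π _ => ?_
  rw [map_mul, map_intCast, map_prod]
  congr 1
  exact prod_congr rfl fun V _ => U.restrictedMoment_eq t ω V

theorem exists_of_coeff_cumulantPoly_ne_zero {n : ℕ} {ω : Fin n → Letter} {k : ℕ}
    (h : (cumulantPoly ω).coeff k ≠ 0) : ∃ j, k + 2 * j = n := by
  rw [cumulantPoly, Polynomial.finsetSum_coeff] at h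
  obtain ⟨π, -, hπ⟩ := exists_ne_zero_of_sum_ne_zero h
  simp only [wordMoment] at hπ
  rw [prod_mul_distrib, prod_pow_eq_pow_sum, ← map_prod,
    ← map_intCast (Polynomial.C (R := ℚ[X])), ← mul_assoc, ← map_mul, Polynomial.coeff_C_mul_X_pow] at hπ
  -- Each partition contributes a single monomial in `y`, whose exponent is the sum of the absolute
  -- net exponents of its blocks.
  have hk : k = ∑ V ∈ π.1.parts, (netExponent ω V).natAbs := by
    by_contra hne
    exact hπ (if_neg hne)
  choose f hf using exists_natAbs_netExponent ω
  refine ⟨∑ V ∈ π.1.parts, f V, ?_⟩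
  rw [hk, mul_sum, ← sum_add_distrib, sum_congr rfl fun V _ => hf V, π.1.sum_card_parts,
    card_univ, Fintype.card_fin]

theorem coeff_cumulantPoly_eq_zero {n : ℕ} (hn : 0 < n) (ω : Fin n → Letter) {j : ℕ}
    (hj : 2 * j ≤ n) (hsw : switchNumber ω < 2 * j) : (cumulantPoly ω).coeff (n - 2 * j) = 0 := by
  have hc : Polynomial.C (momentPoly 0) = (1 : ℚ[X][Y]) := by simp [momentPoly]
  have h := pow_dvd_cumulantOf_wordMoment (fun k => Polynomial.C (momentPoly k)) hc
    (Polynomial.X : ℚ[X][Y]) ω univ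
  rw [← sum_moebOne_mul_prod hn _ (by simp [wordMoment, netExponent, hc])] at h
  have hle := switchesOn_univ_le ω
  rw [card_univ, Fintype.card_fin] at h
  exact Polynomial.X_pow_dvd_iff.1 h _ (by omega)

end FreeBrownian

theorem theorem3p7 (n : ℕ) (hn : 0 < n) (ω : Fin n → FreeBrownian.Letter) :
    ∃ Z : ℚ[X][Y],
      (∀ U : FreeBrownian.FreeUnitaryBrownianMotion.{u},
        FreeBrownian.RepresentsCumulants U ω Z ∧
        ∀ Z' : ℚ[X][Y], FreeBrownian.RepresentsCumulants U ω Z' → Z' = Z) ∧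
      Z = ∑ j ∈ Finset.range (n / 2 + 1),
        Polynomial.C (Z.coeff (n - 2 * j)) * Polynomial.X ^ (n - 2 * j) ∧
      (∀ j : ℕ, 2 * j ≤ n → FreeBrownian.switchNumber ω < 2 * j → Z.coeff (n - 2 * j) = 0) ∧
      (∀ k : ℕ, Z.coeff k ≠ 0 →
        ∃ j : ℕ, j < FreeBrownian.switchNumber ω / 2 + 1 ∧ k + 2 * j = n) := by
  refine ⟨FreeBrownian.cumulantPoly ω, fun U =>
    ⟨FreeBrownian.representsCumulants_cumulantPoly U ω, fun Z' hZ' =>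
      (FreeBrownian.representsCumulants_cumulantPoly U ω).unique hZ'⟩, ?_,
    fun j hj hsw => FreeBrownian.coeff_cumulantPoly_eq_zero hn ω hj hsw, fun k hk => ?_⟩
  · ext1 k
    simp only [Polynomial.finsetSum_coeff, Polynomial.coeff_C_mul_X_pow]
    by_cases hk : (FreeBrownian.cumulantPoly ω).coeff k = 0
    · rw [hk]
      refine (Finset.sum_eq_zero fun j _ => ?_).symm
      split_ifs with h
      · rw [← h, hk]
      · rfl
    · obtain ⟨j, hj⟩ := FreeBrownian.exists_of_coeff_cumulantPoly_ne_zero hk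
      -- For `j ≤ n / 2` the exponents `n - 2 * j` are untruncated and distinct, so exactly one
      -- summand has degree `k`.
      rw [Finset.sum_eq_single_of_mem j (Finset.mem_range.2 (by omega)), if_pos (by omega)]
      · congr 1
        omega
      · intro i hi hij
        rw [Finset.mem_range] at hi
        rw [if_neg (by omega)]
  · obtain ⟨j, hj⟩ := FreeBrownian.exists_of_coeff_cumulantPoly_ne_zero hk
    refine ⟨j, ?_, hj⟩
    by_contra hlt
    refine hk ?_
    have h := FreeBrownian.coeff_cumulantPoly_eq_zero hn ω (j := j) (by omega) (by omega)
    rwa [show n - 2 * j = k by omega] at h
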